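/- \textbf{Setting.} Let $F,f:\mathbb R^n\times\mathbb R^m\to\mathbb R$, $H:\mathbb R^n\times\mathbb R^m\to\mathbb R^p$, $G:\mathbb R^n\times\mathbb R^m\to\mathbb R^q$, $h:\mathbb R^n\times\mathbb R^m\to\mathbb R^r$, $g:\mathbb R^n\times\mathbb R^m\to\mathbb R^s$, and consider the bilevel problem (BP) of minimizing $F(x,y)$ subject to $H(x,y)=0$, $G(x,y)\le 0$ and $y$ solving the lower level problem $(P_x)$: $\min_y f(x,y)$ s.t. $y\in Y(x):=\{y: h(x,y)=0,\ g(x,y)\le 0\}$. Let $\Phi=\{(x,y):H(x,y)=0,\ G(x,y)\le0\}$, let $B_\delta(\cdot)$ be the closed Euclidean ball, $\Pi$ the projection of $\mathbb R^s$ onto $\mathbb R^s_-$, and $\mathcal L(x;y,\mu,\xi)=f(x,y)+\mu^Th(x,y)+\xi^Tg(x,y)$. A point $(x^*,y^*)$ is a \emph{bi-local solution} of (BP) if $(x^*,y^*)\in\Phi$, $y^*\in Y(x^*)$ and there are $\delta_0>0$ and $\eta:(0,\delta_0]\to(0,\infty)$ with $\eta(\delta)\to0$ as $\delta\to0$ such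 that for all $\delta\in(0,\delta_0]$: $f(x^*,y^*)\le f(x^*,z)$ for all $z\in Y(x^*)\cap B_{\eta(\delta)}(y^*)$, and $F(x^*,y^*)\le F(x,y)$ for all $(x,y)\in\Phi\cap[B_\delta(x^*)\times B_{\eta(\delta)}(y^*)]$ with $y\in\operatorname{argmin}_z\{f(x,z):z\in Y(x)\cap B_{\eta(\delta)}(y^*)\}$. The \emph{Jacobian uniqueness conditions} of $(P_x)$ hold at $(y,\mu,\xi)$ if: (a) $\nabla_y\mathcal L(x;y,\mu,\xi)=0$, $h(x,y)=0$, $0\le\xi\perp g(x,y)\le0$; (b) the gradients $\nabla_yh_j(x,y)$ ($1\le j\le r$) and $\nabla_yg_i(x,y)$ ($g_i(x,y)=0$) are linearly independent; (c) $\xi_i-g_i(x,y)>0$ for all $i$; (d) $d^T\nabla^2_{yy}\mathcal L(x;y,\mu,\xi)d>0$ for every $d\ne0$ with $\mathcal J_yh(x,y)d=0$, $\nabla_yg_i(x,y)^Td\le0$ whenever $g_i(x,y)=0$, and $\nabla_yf(x,y)^Td\le0$. \textbf{Theorem (Second-order Sufficient Optimality Conditions).} Let $f,g,h$ be twice continuously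 differentiable around $(x^*,y^*)$ and thrice continuously differentiable with respect to $y$, in the sense that the partial derivatives of $f,g,h$ with respect to $y$ are also twice continuously differentiable in $(x,y)$ around $(x^*,y^*)$; let $F,G,H$ be twice continuously differentiable around $(x^*,y^*)$. Assume $(x^*,y^*)\in\Phi$, $y^*\in Y(x^*)$, and that the Jacobian uniqueness conditions of $(P_{x^*})$ hold at $(y^*,\mu^*,\xi^*)$. Then there are $\delta_1,\varepsilon_1>0$ and a mapping $(y,\mu,\xi):B_{\delta_1}(x^*)\to B_{\varepsilon_1}(y^*)\times B_{\varepsilon_1}(\mu^*)\times B_{\varepsilon_1}(\xi^*)$, twice continuously differentiable, with $(y,\mu,\xi)(x^*)=(y^*,\mu^*,\xi^*)$, such that the Jacobian uniqueness conditions of $(P_x)$ hold at $(y(x),\mu(x),\xi(x))$ for all $x\in B_{\delta_1}(x^*)$. For any $\delta_1,\varepsilon_1$ and any such mapping, even if it is only assumed continuously differentiable, $y(\cdot)$ is twice continuously differentiable around $x^*$ and the following holds. Define $L^{SP}(x;\lambda_H,\lambda_G)=F(x,y(x))+\lambda_H^TH(x,y(x))+\lambda_G^TG(x,y(x))$; let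 $\Lambda(x^*)$ be the set of $(\lambda_H,\lambda_G)$ with $\nabla_xL^{SP}(x^*;\lambda_H,\lambda_G)=0$, $H(x^*,y^*)=0$, $0\le\lambda_G\perp G(x^*,y^*)\le0$; and let $\mathcal C(x^*)$ be the set of $d_x\in\mathbb R^n$ with $(\mathcal J_xH+\mathcal J_yH\,\mathcal Jy(x^*))d_x=0$, $(\nabla_xG_i^T+\nabla_yG_i^T\mathcal Jy(x^*))d_x\le0$ whenever $G_i(x^*,y^*)=0$, and $(\nabla_xF^T+\nabla_yF^T\mathcal Jy(x^*))d_x\le0$ (derivatives at $(x^*,y^*)$). With $u=(x,y,\mu,\xi)$ and $\lambda=(\lambda_H,\lambda_G,\lambda_{\mathcal L},\lambda_h,\lambda_g)$, define $$L^{FP}(u;\lambda)=F+\lambda_H^TH+\lambda_G^TG+\lambda_{\mathcal L}^T\nabla_y\mathcal L(x;y,\mu,\xi)+\lambda_h^Th+\lambda_g^T\bigl(g-\Pi(g+\xi)\bigr)$$ (functions at $(x,y)$); with $u^*=(x^*,y^*,\mu^*,\xi^*)$ let $\Lambda(u^*)$ be the set of $\lambda$ with $\nabla_uL^{FP}(u^*;\lambda)=0$,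 $H(x^*,y^*)=0$, $0\le\lambda_G\perp G(x^*,y^*)\le0$, $\nabla_y\mathcal L(x^*;y^*,\mu^*,\xi^*)=0$, $h(x^*,y^*)=0$, $g(x^*,y^*)-\Pi(g(x^*,y^*)+\xi^*)=0$; and let $\mathcal C(u^*)$ be the set of $d=(d_x,d_y,d_\mu,d_\xi)$ with $\nabla_xG_i^Td_x+\nabla_yG_i^Td_y\le0$ whenever $G_i(x^*,y^*)=0$, $\nabla_xF^Td_x+\nabla_yF^Td_y\le0$, and $Ad=0$, where $$A=\begin{bmatrix}\mathcal J_xH&\mathcal J_yH&0&0\\ \nabla^2_{yx}\mathcal L&\nabla^2_{yy}\mathcal L&\mathcal J_yh^T&\mathcal J_yg^T\\ \mathcal J_xh&\mathcal J_yh&0&0\\ (I-W)\mathcal J_xg&(I-W)\mathcal J_yg&0&-W\end{bmatrix},\qquad W=\mathcal J\Pi(g(x^*,y^*)+\xi^*),$$ at $u^*$. Then the following are equivalent (suprema in $[-\infty,\infty]$): (i) $\Lambda(x^*)\ne\emptyset$, and $\displaystyle\sup_{(\lambda_H,\lambda_G)\in\Lambda(x^*)}d_x^T\nabla^2_{xx}L^{SP}(x^*;\lambda_H,\lambda_G)d_x>0$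 for every $d_x\in\mathcal C(x^*)\setminus\{0\}$; (ii) $\Lambda(u^*)\ne\emptyset$, and $\displaystyle\sup_{\lambda\in\Lambda(u^*)}d^T\nabla^2_{uu}L^{FP}(u^*;\lambda)d>0$ for every $d\in\mathcal C(u^*)\setminus\{0\}$. Furthermore, if (i) or (ii) holds, there are $\delta_2\in(0,\delta_1)$, $\varepsilon_2\in(0,\varepsilon_1)$ and $\gamma>0$ such that for every $x\in B_{\delta_2}(x^*)$ the point $y(x)$ is the unique minimizer of $f(x,\cdot)$ over $Y(x)\cap B_{\varepsilon_2}(y^*)$, and, if $(x,y(x))\in\Phi$, $$F(x,y(x))\ge F(x^*,y^*)+\gamma\|x-x^*\|^2;$$ moreover $(x^*,y^*)$ is a bi-local solution of (BP). -/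

import Mathlib

open Set Filter Topology

/-- The space `ℝᵏ` with the Euclidean norm and inner product. -/
abbrev Euc (k : ℕ) : Type := EuclideanSpace ℝ (Fin k)

/-- The metric projection of `ℝˢ` onto the nonpositive orthant, `v ↦ (min (v i) 0)ᵢ`. -/
noncomputable def projNonpos {s : ℕ} (v : Euc s) : Euc s :=
  WithLp.toLp 2 (fun i => min (v i) 0)

/-- `projNonpos v` lies in the nonpositive orthant and is a nearest point of it to `v`. -/
theorem projNonpos_isProjection {s : ℕ} (v : Euc s) :
    (∀ i, projNonpos v i ≤ 0) ∧
      ∀ w : Euc s, (∀ i, w i ≤ 0) → ‖v - projNonpos v‖ ≤ ‖v - w‖ := by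
  refine ⟨fun i => min_le_right _ _, fun w hw => ?_⟩
  rw [EuclideanSpace.norm_eq, EuclideanSpace.norm_eq]
  refine Real.sqrt_le_sqrt (Finset.sum_le_sum fun i _ => ?_)
  have hi := hw i
  simp only [projNonpos, PiLp.sub_apply, Real.norm_eq_abs, sq_abs]
  rcases le_total (v i) 0 with h | h
  · rw [min_eq_left h]; nlinarith [sq_nonneg (v i - w i)]
  · rw [min_eq_right h]; nlinarith

/-- The quadratic form `d ↦ dᵀ ∇²φ(u) d` of the Hessian of `φ` at `u`. -/
noncomputable def hessQuad {V : Type*} [NormedAddCommGroup V] [NormedSpace ℝ V]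
    (φ : V → ℝ) (u d : V) : ℝ :=
  fderiv ℝ (fderiv ℝ φ) u d d

/-- `φ` is twice continuously differentiable around `z` and thrice continuously differentiable
with respect to its second variable: `φ` is `C²` near `z` and so is the partial derivative of `φ`
in the second variable, as a function of both variables. -/
def IsC2C3Snd {n m : ℕ} {V : Type*} [NormedAddCommGroup V] [NormedSpace ℝ V]
    (φ : Euc n × Euc m → V) (z : Euc n × Euc m) : Prop :=
  ContDiffAt ℝ 2 φ z ∧
    ContDiffAt ℝ 2 (fun w : Euc n × Euc m => fderiv ℝ (fun y => φ (w.1, y)) w.2) z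

/-- The data of the bilevel program: minimize `F(x,y)` subject to `H(x,y) = 0`, `G(x,y) ≤ 0` and
`y` solving the lower level problem `(P_x)`: minimize `f(x,y)` over `y` subject to `h(x,y) = 0`,
`g(x,y) ≤ 0`. -/
structure BilevelProgram (n m p q r s : ℕ) where
  F : Euc n × Euc m → ℝ
  H : Euc n × Euc m → Euc p
  G : Euc n × Euc m → Euc q
  f : Euc n × Euc m → ℝ
  h : Euc n × Euc m → Euc r
  g : Euc n × Euc m → Euc s

namespace BilevelProgram

variable {n m p q r s : ℕ}

/-- The set `Φ` cut out by the upper level constraints. -/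
def Phi (P : BilevelProgram n m p q r s) : Set (Euc n × Euc m) :=
  {z | P.H z = 0 ∧ ∀ i, P.G z i ≤ 0}

/-- The feasible set `Y(x)` of the lower level problem `(P_x)`. -/
def Y (P : BilevelProgram n m p q r s) (x : Euc n) : Set (Euc m) :=
  {y | P.h (x, y) = 0 ∧ ∀ i, P.g (x, y) i ≤ 0}

/-- The set `argmin_z {f(x,z) : z ∈ Y(x) ∩ B_ε(c)}`. -/
def localArgmin (P : BilevelProgram n m p q r s) (x : Euc n) (c : Euc m) (ε : ℝ) :
    Set (Euc m) :=
  {y | y ∈ P.Y x ∩ Metric.closedBall c ε ∧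
    ∀ z ∈ P.Y x ∩ Metric.closedBall c ε, P.f (x, y) ≤ P.f (x, z)}

/-- `(xs, ys)` is a bi-local optimal solution. -/
def IsBiLocalSolution (P : BilevelProgram n m p q r s) (xs : Euc n) (ys : Euc m) : Prop :=
  (xs, ys) ∈ P.Phi ∧ ys ∈ P.Y xs ∧
    ∃ δ₀ : ℝ, 0 < δ₀ ∧ ∃ η : ℝ → ℝ, (∀ δ ∈ Ioc 0 δ₀, 0 < η δ) ∧
      Tendsto η (𝓝[>] 0) (𝓝 0) ∧
      ∀ δ ∈ Ioc 0 δ₀,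
        (∀ z ∈ P.Y xs ∩ Metric.closedBall ys (η δ), P.f (xs, ys) ≤ P.f (xs, z)) ∧
        ∀ (x : Euc n) (y : Euc m), (x, y) ∈ P.Phi → x ∈ Metric.closedBall xs δ →
          y ∈ Metric.closedBall ys (η δ) → y ∈ P.localArgmin x ys (η δ) →
          P.F (xs, ys) ≤ P.F (x, y)

/-! ### The lower level problem -/

/-- The lower level Lagrangian `ℒ(x; y, μ, ξ) = f(x,y) + μᵀh(x,y) + ξᵀg(x,y)`. -/
noncomputable def lowerLagrangian (P : BilevelProgram n m p q r s)
    (x : Euc n) (y : Euc m) (μ : Euc r) (ξ : Euc s) : ℝ :=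
  P.f (x, y) + inner ℝ μ (P.h (x, y)) + inner ℝ ξ (P.g (x, y))

/-- The gradient `∇_y ℒ(x; y, μ, ξ)`. -/
noncomputable def gradYLagrangian (P : BilevelProgram n m p q r s)
    (x : Euc n) (y : Euc m) (μ : Euc r) (ξ : Euc s) : Euc m :=
  gradient (fun y' => P.lowerLagrangian x y' μ ξ) y

/-- The critical cone `𝒞_x(y)` of the lower level problem `(P_x)` at `y`. -/
def lowerCriticalCone (P : BilevelProgram n m p q r s) (x : Euc n) (y : Euc m) : Set (Euc m) :=
  {d | fderiv ℝ (fun y' => P.h (x, y')) y d = 0 ∧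
    (∀ i, P.g (x, y) i = 0 → fderiv ℝ (fun y' => P.g (x, y') i) y d ≤ 0) ∧
    fderiv ℝ (fun y' => P.f (x, y')) y d ≤ 0}

/-- The Jacobian uniqueness conditions of the lower level problem `(P_x)` at `(y, μ, ξ)`: the KKT
conditions, the linear independence constraint qualification, strict complementarity, and the
second-order sufficient condition. -/
structure JacobianUniqueness (P : BilevelProgram n m p q r s)
    (x : Euc n) (y : Euc m) (μ : Euc r) (ξ : Euc s) : Prop where
  stationary : P.gradYLagrangian x y μ ξ = 0
  eq_feasible : P.h (x, y) = 0
  ineq_feasible : ∀ i, P.g (x, y) i ≤ 0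
  multiplier_nonneg : ∀ i, 0 ≤ ξ i
  complementary : inner ℝ ξ (P.g (x, y)) = 0
  licq : LinearIndependent ℝ
    (Sum.elim (fun j : Fin r => gradient (fun y' => P.h (x, y') j) y)
      (fun i : {i : Fin s // P.g (x, y) i = 0} => gradient (fun y' => P.g (x, y') i.1) y))
  strict : ∀ i, 0 < ξ i - P.g (x, y) i
  sosc : ∀ d ∈ P.lowerCriticalCone x y, d ≠ 0 →
    0 < hessQuad (fun y' => P.lowerLagrangian x y' μ ξ) y d

/-- `x ↦ (y(x), μ(x), ξ(x))` is a `Cᵏ` mapping from the closed ball `B_δ(xs)` to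
`B_ε(ys) × B_ε(μs) × B_ε(ξs)`, with value `(ys, μs, ξs)` at `xs`, such that the Jacobian uniqueness
conditions of `(P_x)` hold at `(y(x), μ(x), ξ(x))` for every `x` in `B_δ(xs)`. -/
structure IsSolutionBranch (P : BilevelProgram n m p q r s) (k : ℕ)
    (xs : Euc n) (ys : Euc m) (μs : Euc r) (ξs : Euc s) (δ ε : ℝ)
    (y : Euc n → Euc m) (μ : Euc n → Euc r) (ξ : Euc n → Euc s) : Prop where
  radius_pos : 0 < δ
  target_radius_pos : 0 < ε
  y_center : y xs = ys
  μ_center : μ xs = μs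
  ξ_center : ξ xs = ξs
  y_contDiffOn : ContDiffOn ℝ k y (Metric.closedBall xs δ)
  μ_contDiffOn : ContDiffOn ℝ k μ (Metric.closedBall xs δ)
  ξ_contDiffOn : ContDiffOn ℝ k ξ (Metric.closedBall xs δ)
  y_mem : ∀ x ∈ Metric.closedBall xs δ, y x ∈ Metric.closedBall ys ε
  μ_mem : ∀ x ∈ Metric.closedBall xs δ, μ x ∈ Metric.closedBall μs ε
  ξ_mem : ∀ x ∈ Metric.closedBall xs δ, ξ x ∈ Metric.closedBall ξs ε
  jacobianUniqueness : ∀ x ∈ Metric.closedBall xs δ, P.JacobianUniqueness x (y x) (μ x) (ξ x)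

/-! ### The implicit reformulation (SP)

Minimize `F(x, y(x))` subject to `H(x, y(x)) = 0` and `G(x, y(x)) ≤ 0`. -/

/-- The Lagrangian `L^SP(x; λ_H, λ_G)`. -/
noncomputable def lagrangianSP (P : BilevelProgram n m p q r s) (y : Euc n → Euc m)
    (l : Euc p × Euc q) (x : Euc n) : ℝ :=
  P.F (x, y x) + inner ℝ l.1 (P.H (x, y x)) + inner ℝ l.2 (P.G (x, y x))

/-- The set `Λ(xs)` of the multipliers `(λ_H, λ_G)` of (SP) at `xs`. -/
def multipliersSP (P : BilevelProgram n m p q r s) (y : Euc n → Euc m) (xs : Euc n) :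
    Set (Euc p × Euc q) :=
  {l | fderiv ℝ (P.lagrangianSP y l) xs = 0 ∧
    P.H (xs, y xs) = 0 ∧
    (∀ i, 0 ≤ l.2 i) ∧ (∀ i, P.G (xs, y xs) i ≤ 0) ∧ inner ℝ l.2 (P.G (xs, y xs)) = 0}

/-- The critical cone `𝒞(xs)` of (SP). -/
def criticalConeSP (P : BilevelProgram n m p q r s) (y : Euc n → Euc m) (xs : Euc n) :
    Set (Euc n) :=
  {d | fderiv ℝ (fun x => P.H (x, y xs)) xs d +
        fderiv ℝ (fun z => P.H (xs, z)) (y xs) (fderiv ℝ y xs d) = 0 ∧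
    (∀ i, P.G (xs, y xs) i = 0 →
      fderiv ℝ (fun x => P.G (x, y xs) i) xs d +
        fderiv ℝ (fun z => P.G (xs, z) i) (y xs) (fderiv ℝ y xs d) ≤ 0) ∧
    fderiv ℝ (fun x => P.F (x, y xs)) xs d +
        fderiv ℝ (fun z => P.F (xs, z)) (y xs) (fderiv ℝ y xs d) ≤ 0}

/-- The second-order sufficient optimality condition of (SP) at `xs`. The supremum is taken in the
extended reals since the set of multipliers need not be bounded. -/
def SOSCSP (P : BilevelProgram n m p q r s) (y : Euc n → Euc m) (xs : Euc n) : Prop :=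
  (P.multipliersSP y xs).Nonempty ∧
    ∀ d ∈ P.criticalConeSP y xs, d ≠ 0 →
      (0 : EReal) < ⨆ l ∈ P.multipliersSP y xs, ((hessQuad (P.lagrangianSP y l) xs d : ℝ) : EReal)

/-! ### The first-order reformulation (FP)

Minimize `F(x,y)` over `u = (x, y, μ, ξ)` subject to `H(x,y) = 0`, `G(x,y) ≤ 0`,
`∇_y ℒ(x; y, μ, ξ) = 0`, `h(x,y) = 0` and `g(x,y) - Π(g(x,y) + ξ) = 0`, where `Π` is the projection
onto the nonpositive orthant. -/

/-- The Lagrangian `L^FP(u; λ)` with `u = (x, y, μ, ξ)` and `λ = (λ_H, λ_G, λ_ℒ, λ_h, λ_g)`. -/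
noncomputable def lagrangianFP (P : BilevelProgram n m p q r s)
    (l : Euc p × Euc q × Euc m × Euc r × Euc s) (u : Euc n × Euc m × Euc r × Euc s) : ℝ :=
  match l, u with
  | (lH, lG, lL, lh, lg), (x, y, μ, ξ) =>
    P.F (x, y) + inner ℝ lH (P.H (x, y)) + inner ℝ lG (P.G (x, y))
      + inner ℝ lL (P.gradYLagrangian x y μ ξ)
      + inner ℝ lh (P.h (x, y))
      + inner ℝ lg (P.g (x, y) - projNonpos (P.g (x, y) + ξ))

/-- The set `Λ(x, y, μ, ξ)` of the multipliers `(λ_H, λ_G, λ_ℒ, λ_h, λ_g)` of (FP). -/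
def multipliersFP (P : BilevelProgram n m p q r s)
    (x : Euc n) (y : Euc m) (μ : Euc r) (ξ : Euc s) :
    Set (Euc p × Euc q × Euc m × Euc r × Euc s) :=
  {l | fderiv ℝ (P.lagrangianFP l) (x, y, μ, ξ) = 0 ∧
    P.H (x, y) = 0 ∧
    (∀ i, 0 ≤ l.2.1 i) ∧ (∀ i, P.G (x, y) i ≤ 0) ∧ inner ℝ l.2.1 (P.G (x, y)) = 0 ∧
    P.gradYLagrangian x y μ ξ = 0 ∧
    P.h (x, y) = 0 ∧
    P.g (x, y) - projNonpos (P.g (x, y) + ξ) = 0}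

/-- The critical cone `𝒞(x, y, μ, ξ)` of (FP). The last four equations say `A d = 0` for
`A = [J_x H, J_y H, 0, 0; ∇²_yx ℒ, ∇²_yy ℒ, (J_y h)ᵀ, (J_y g)ᵀ; J_x h, J_y h, 0, 0;`
`(I - W) J_x g, (I - W) J_y g, 0, -W]`, where `W` is the Jacobian of the projection onto the
nonpositive orthant at `g(x,y) + ξ`. -/
def criticalConeFP (P : BilevelProgram n m p q r s)
    (x : Euc n) (y : Euc m) (μ : Euc r) (ξ : Euc s) :
    Set (Euc n × Euc m × Euc r × Euc s) :=
  {d | ∃ dx dy dμ dξ, d = (dx, dy, dμ, dξ) ∧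
    (∀ i, P.G (x, y) i = 0 →
      fderiv ℝ (fun x' => P.G (x', y) i) x dx + fderiv ℝ (fun y' => P.G (x, y') i) y dy ≤ 0) ∧
    fderiv ℝ (fun x' => P.F (x', y)) x dx + fderiv ℝ (fun y' => P.F (x, y')) y dy ≤ 0 ∧
    fderiv ℝ (fun x' => P.H (x', y)) x dx + fderiv ℝ (fun y' => P.H (x, y')) y dy = 0 ∧
    fderiv ℝ (fun x' => P.gradYLagrangian x' y μ ξ) x dx +
      fderiv ℝ (fun y' => P.gradYLagrangian x y' μ ξ) y dy +
      (fderiv ℝ (fun y' => P.h (x, y')) y).adjoint dμ +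
      (fderiv ℝ (fun y' => P.g (x, y')) y).adjoint dξ = 0 ∧
    fderiv ℝ (fun x' => P.h (x', y)) x dx + fderiv ℝ (fun y' => P.h (x, y')) y dy = 0 ∧
    (ContinuousLinearMap.id ℝ (Euc s) - fderiv ℝ projNonpos (P.g (x, y) + ξ))
        (fderiv ℝ (fun x' => P.g (x', y)) x dx) +
      (ContinuousLinearMap.id ℝ (Euc s) - fderiv ℝ projNonpos (P.g (x, y) + ξ))
        (fderiv ℝ (fun y' => P.g (x, y')) y dy) -
      fderiv ℝ projNonpos (P.g (x, y) + ξ) dξ = 0}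

/-- The second-order sufficient optimality condition of (FP) at `(x, y, μ, ξ)`. -/
def SOSCFP (P : BilevelProgram n m p q r s)
    (x : Euc n) (y : Euc m) (μ : Euc r) (ξ : Euc s) : Prop :=
  (P.multipliersFP x y μ ξ).Nonempty ∧
    ∀ d ∈ P.criticalConeFP x y μ ξ, d ≠ 0 →
      (0 : EReal) < ⨆ l ∈ P.multipliersFP x y μ ξ,
        ((hessQuad (P.lagrangianFP l) (x, y, μ, ξ) d : ℝ) : EReal)

end BilevelProgram

/-!
Near `u* = (x*, y*, μ*, ξ*)` the Karush-Kuhn-Tucker points of the lower level problems are the zeros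
of `K(u) = (∇_y ℒ, h, g - Π(g + ξ))`, `BilevelProgram.kktMap`. Strict complementarity keeps `g + ξ`
away from the kinks of `Π`, so `K` is `C²` near `u*`, although `Π` is not differentiable. The linear
independence and second order conditions make the partial derivative of `K` in `(y, μ, ξ)` injective
(`JacobianUniqueness.isInvertible`). The implicit function theorem then gives a `C²` map
`x ↦ v(x) = (y, μ, ξ)(x)` whose graph is the set of zeros of `K` near `u*`. The Jacobian uniqueness
conditions are stable along zeros of `K` (`JacobianUniqueness.eventually_of_kktMap_eq_zero`), which
gives the solution branch; conversely every continuous branch consists of zeros of `K` and so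
coincides with `v` near `x*` (`IsSolutionBranch.contDiffAt`).

The first order reformulation has the constraint `K(u) = 0` in addition to the upper level ones, and
`L^FP = F + ⟨λ_H, H⟩ + ⟨λ_G, G⟩ + ⟨λ', K⟩` restricts to `L^SP` on the graph of `v`. Three
observations then yield the equivalence `IsKKTCurve.SOSCSP_iff_SOSCFP`:
* forgetting `λ'` maps the multipliers of (FP) onto those of (SP), since `λ'` can be recovered by
  solving an adjoint equation with the invertible partial derivative of `K`;
* the critical cone of (FP) is the set of `(d, v'(x*) d)` with `d` in the critical cone of (SP),
  since `K'(u*)(d, w) = 0` if and only if `w = v'(x*) d`;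
* for a multiplier of (FP) the gradient of `L^FP` vanishes at `u*`, so that the second derivative of
  `v` drops out of the chain rule and the two Hessians agree on corresponding directions.

The growth statements are of the form "eventually for all points", and compactness of the unit
sphere (`eventually_of_forall_direction`) reduces them to a neighbourhood of a single direction `d`.
If `d` is not critical, a first order estimate excludes feasible points in directions near `d`, or
makes the objective grow linearly. If `d` is critical, a Taylor expansion of the Lagrangian, for a
multiplier chosen for `d`, gives quadratic growth. For (SP) this is `exists_quadratic_growth`. In
the lower level the same argument is uniform in the parameter `x`
(`JacobianUniqueness.eventually_lt`), because strict differentiability makes the estimates uniform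
in the base point (`eventually_abs_sub_taylor_two_le`).
-/

/-! ### Directional estimates -/

/-- Compactness of the unit sphere: a property that holds eventually near each unit direction holds
eventually for all unit directions at once. -/
theorem eventually_forall_unit {V α : Type*} [NormedAddCommGroup V] [NormedSpace ℝ V]
    [FiniteDimensional ℝ V] {l : Filter α} {Q : α → V → Prop}
    (H : ∀ d : V, ‖d‖ = 1 → ∀ᶠ q in l ×ˢ 𝓝 d, Q q.1 q.2) :
    ∀ᶠ a in l, ∀ d : V, ‖d‖ = 1 → Q a d := by
  have h := IsCompact.mem_prod_nhdsSet_of_forall (l := l) (s := {q : α × V | Q q.1 q.2})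
    (isCompact_sphere (0 : V) 1) (fun d hd => H d (by simpa using hd))
  obtain ⟨s, hs, t, ht, hst⟩ := Filter.mem_prod_iff.1 h
  filter_upwards [hs] with a ha d hd
  exact hst (Set.mk_mem_prod ha (subset_of_mem_nhdsSet ht (by simpa using hd)))

/-- To prove `Q a` eventually where `w a ≠ 0`, it suffices to do so, for each unit direction `d`,
when the direction of `w a` is close to `d`. -/
theorem eventually_of_forall_direction {V α : Type*} [NormedAddCommGroup V] [NormedSpace ℝ V]
    [FiniteDimensional ℝ V] {l : Filter α} {w : α → V} {Q : α → Prop}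
    (H : ∀ d : V, ‖d‖ = 1 →
      ∀ᶠ q in l ×ˢ 𝓝 d, w q.1 ≠ 0 → w q.1 = ‖w q.1‖ • q.2 → Q q.1) :
    ∀ᶠ a in l, w a ≠ 0 → Q a := by
  filter_upwards [eventually_forall_unit
    (Q := fun a d => w a ≠ 0 → w a = ‖w a‖ • d → Q a) H] with a ha hw
  have hn : ‖w a‖ ≠ 0 := norm_ne_zero_iff.2 hw
  refine ha (‖w a‖⁻¹ • w a) ?_ hw ?_
  · rw [norm_smul, norm_inv, norm_norm, inv_mul_cancel₀ hn]
  · rw [smul_smul, mul_inv_cancel₀ hn, one_smul]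

/-- First order growth of a strictly differentiable function along steps whose direction is close
to a direction of increase. -/
theorem HasStrictFDerivAt.eventually_mul_le_sub {E : Type*} [NormedAddCommGroup E]
    [NormedSpace ℝ E] {f : E → ℝ} {f' : E →L[ℝ] ℝ} {x₀ d : E} {c : ℝ}
    (hf : HasStrictFDerivAt f f' x₀) (hc : c < f' d) :
    ∀ᶠ q : (E × E) × E in 𝓝 (x₀, x₀) ×ˢ 𝓝 d, ∀ t : ℝ, 0 ≤ t →
      q.1.2 - q.1.1 = t • q.2 → c * t ≤ f q.1.2 - f q.1.1 := by
  -- `ε` leaves room for the error `ε * ‖d‖` of strict differentiability: `c < f' d - ε * ‖d‖`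
  set ε : ℝ := (f' d - c) / (2 * (‖d‖ + 1)) with hε
  have hd : 0 < ‖d‖ + 1 := by positivity
  have hεpos : 0 < ε := div_pos (by linarith) (by positivity)
  have h1 : ∀ᶠ e in 𝓝 d, c < f' e - ε * ‖e‖ := by
    have hcont : ContinuousAt (fun e => f' e - ε * ‖e‖) d := by fun_prop
    refine hcont.eventually (lt_mem_nhds ?_)
    have : ε * (2 * (‖d‖ + 1)) = f' d - c := div_mul_cancel₀ _ (by positivity)
    nlinarith [norm_nonneg d]
  have h2 := (hf.isLittleO.bound hεpos)
  filter_upwards [h2.prod_mk h1] with q hq t ht hqt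
  obtain ⟨ha, hb⟩ := hq
  have hqt' : q.1.1 - q.1.2 = (-t) • q.2 := by rw [← neg_sub, hqt, neg_smul]
  rw [hqt', map_smul, norm_smul, norm_neg, Real.norm_of_nonneg ht, Real.norm_eq_abs,
    smul_eq_mul] at ha
  have := (abs_le.1 ha).2
  nlinarith [mul_le_mul_of_nonneg_left hb.le ht]

/-- Second order Taylor expansion in `v`, uniform in a parameter `a` and in the base point, at a
point where the derivative in `v` is strictly differentiable in `(a, v)`. -/
theorem eventually_abs_sub_taylor_two_le {A V : Type*} [NormedAddCommGroup A] [NormedSpace ℝ A]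
    [NormedAddCommGroup V] [NormedSpace ℝ V] {φ : A → V → ℝ} {ψ : A × V → V →L[ℝ] ℝ}
    {ψ' : A × V →L[ℝ] V →L[ℝ] ℝ} {a₀ : A} {v₀ : V}
    (hφ : ∀ᶠ w in 𝓝 (a₀, v₀), HasFDerivAt (φ w.1) (ψ w) w.2)
    (hψ : HasStrictFDerivAt ψ ψ' (a₀, v₀)) {ε : ℝ} (hε : 0 < ε) :
    ∀ᶠ w : A × V × V in 𝓝 (a₀, v₀, v₀),
      |φ w.1 w.2.2 - φ w.1 w.2.1 - ψ (w.1, w.2.1) (w.2.2 - w.2.1)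
        - ψ' (0, w.2.2 - w.2.1) (w.2.2 - w.2.1) / 2| ≤ ε * ‖w.2.2 - w.2.1‖ ^ 2 := by
  have hsymm : ∀ v w, ψ' (0, v) w = ψ' (0, w) v := by
    have hc : ContinuousAt (fun v : V => (a₀, v)) v₀ := by fun_prop
    have h2 : HasFDerivAt (fun v => ψ (a₀, v))
        (ψ'.comp (ContinuousLinearMap.inr ℝ A V)) v₀ :=
      hψ.hasFDerivAt.comp v₀ (hasFDerivAt_prodMk_right a₀ v₀)
    exact second_derivative_symmetric_of_eventually (f := φ a₀) (hc.eventually hφ) h2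
  obtain ⟨r, hr, hball⟩ := Metric.eventually_nhds_iff_ball.1 hφ
  obtain ⟨r', hr', hball'⟩ := Metric.eventually_nhds_iff_ball.1 (hψ.isLittleO.bound hε)
  set ρ := min r r' with hρ
  have hρpos : 0 < ρ := lt_min hr hr'
  filter_upwards [Metric.ball_mem_nhds (a₀, v₀, v₀) hρpos] with w hw
  obtain ⟨a, y, z⟩ := w
  simp only [Metric.mem_ball, Prod.dist_eq, max_lt_iff] at hw
  obtain ⟨ha, hy, hz⟩ := hw
  have hseg : ∀ v ∈ segment ℝ y z, dist v v₀ < ρ := fun v hv =>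
    (convex_ball v₀ ρ).segment_subset hy hz hv
  -- the mean value inequality on the segment `[y, z]` for the remainder `R`; its derivative is
  -- small by strict differentiability of `ψ` and symmetry of the second derivative
  set R : V → ℝ := fun v => φ a v - ψ (a, y) (v - y) - ψ' (0, v - y) (v - y) / 2 with hR
  have hder : ∀ v ∈ segment ℝ y z,
      HasFDerivWithinAt R (ψ (a, v) - ψ (a, y) - ψ' (0, v - y)) (segment ℝ y z) v := by
    intro v hv
    have h1 : HasFDerivAt (φ a) (ψ (a, v)) v := (hball (a, v) (by
      simp only [Metric.mem_ball, Prod.dist_eq, max_lt_iff]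
      exact ⟨ha.trans_le (min_le_left _ _), (hseg v hv).trans_le (min_le_left _ _)⟩))
    have hid : HasFDerivAt (fun v : V => v - y) (ContinuousLinearMap.id ℝ V) v :=
      (hasFDerivAt_id v).sub_const y
    have h2 : HasFDerivAt (fun v => ψ (a, y) (v - y)) (ψ (a, y)) v :=
      (ψ (a, y)).hasFDerivAt.comp v hid
    have h3 : HasFDerivAt (fun v => ψ'.comp (ContinuousLinearMap.inr ℝ A V) (v - y))
        (ψ'.comp (ContinuousLinearMap.inr ℝ A V)) v :=
      (ψ'.comp (ContinuousLinearMap.inr ℝ A V)).hasFDerivAt.comp v hid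
    have h4 := (h3.clm_apply hid).mul_const (1 / 2 : ℝ)
    have h5 := (h1.sub h2).sub h4
    refine HasFDerivAt.hasFDerivWithinAt ?_
    convert! h5 using 1
    · ext v; simp [hR]; ring
    · ext u
      simp only [sub_apply, smul_apply,
        add_apply, ContinuousLinearMap.comp_apply,
        ContinuousLinearMap.flip_apply, ContinuousLinearMap.inr_apply,
        ContinuousLinearMap.id_apply, smul_eq_mul]
      rw [hsymm u (v - y)]; ring
  have hbound : ∀ v ∈ segment ℝ y z, ‖ψ (a, v) - ψ (a, y) - ψ' (0, v - y)‖ ≤ ε * ‖z - y‖ := by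
    intro v hv
    have h1 := hball' ((a, v), (a, y)) (by
      simp only [Metric.mem_ball, Prod.dist_eq, max_lt_iff]
      exact ⟨⟨ha.trans_le (min_le_right _ _), (hseg v hv).trans_le (min_le_right _ _)⟩,
        ha.trans_le (min_le_right _ _), hy.trans_le (min_le_right _ _)⟩)
    simp only [Prod.mk_sub_mk, sub_self] at h1
    refine h1.trans (mul_le_mul_of_nonneg_left ?_ hε.le)
    have : ‖v - y‖ ≤ ‖z - y‖ := by
      obtain ⟨s, ⟨hs0, hs1⟩, rfl⟩ := (segment_eq_image' ℝ y z ▸ hv :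
        v ∈ (fun θ : ℝ => y + θ • (z - y)) '' Icc 0 1)
      rw [add_sub_cancel_left, norm_smul, Real.norm_of_nonneg hs0]
      exact mul_le_of_le_one_left (norm_nonneg _) hs1
    simpa [Prod.norm_def] using this
  have := Convex.norm_image_sub_le_of_norm_hasFDerivWithin_le (𝕜 := ℝ) hder hbound
    (convex_segment y z) (left_mem_segment ℝ y z) (right_mem_segment ℝ y z)
  rw [Real.norm_eq_abs] at this
  have hz0 : ψ' (0, (0 : V)) = 0 := by rw [← Prod.zero_eq_mk, map_zero]
  simp only [hR, sub_self, map_zero, hz0] at this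
  calc _ = _ := by
        congr 1
        ring
    _ ≤ _ := this
    _ = _ := by ring

/-- Second order growth along steps whose direction is close to a direction of positive
curvature. -/
theorem eventually_add_mul_sq_le {A V : Type*} [NormedAddCommGroup A] [NormedSpace ℝ A]
    [NormedAddCommGroup V] [NormedSpace ℝ V] {φ : A → V → ℝ} {ψ : A × V → V →L[ℝ] ℝ}
    {ψ' : A × V →L[ℝ] V →L[ℝ] ℝ} {a₀ : A} {v₀ d : V} {c : ℝ}
    (hφ : ∀ᶠ w in 𝓝 (a₀, v₀), HasFDerivAt (φ w.1) (ψ w) w.2)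
    (hψ : HasStrictFDerivAt ψ ψ' (a₀, v₀)) (hc : c < ψ' (0, d) d / 2) :
    ∀ᶠ q : (A × V × V) × V in 𝓝 (a₀, v₀, v₀) ×ˢ 𝓝 d, ∀ t : ℝ,
      q.1.2.2 - q.1.2.1 = t • q.2 →
      φ q.1.1 q.1.2.1 + ψ (q.1.1, q.1.2.1) (q.1.2.2 - q.1.2.1) + c * t ^ 2
        ≤ φ q.1.1 q.1.2.2 := by
  -- `ε` leaves room for the Taylor error: `c < ψ' (0, d) d / 2 - ε * ‖d‖ ^ 2`
  set ε : ℝ := (ψ' (0, d) d / 2 - c) / (2 * (‖d‖ ^ 2 + 1)) with hε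
  have hεpos : 0 < ε := div_pos (by linarith) (by positivity)
  have h1 : ∀ᶠ e in 𝓝 d, c < ψ' (0, e) e / 2 - ε * ‖e‖ ^ 2 := by
    have hcont : ContinuousAt (fun e => ψ' (0, e) e / 2 - ε * ‖e‖ ^ 2) d := by fun_prop
    refine hcont.eventually (lt_mem_nhds ?_)
    have : ε * (2 * (‖d‖ ^ 2 + 1)) = ψ' (0, d) d / 2 - c := div_mul_cancel₀ _ (by positivity)
    nlinarith [sq_nonneg ‖d‖]
  have h2 := eventually_abs_sub_taylor_two_le hφ hψ hεpos
  filter_upwards [h2.prod_mk h1] with q hq t hqt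
  obtain ⟨ha, hb⟩ := hq
  have hB : ψ' (0, t • q.2) (t • q.2) = t ^ 2 * ψ' (0, q.2) q.2 := by
    have : ((0 : A), t • q.2) = t • ((0 : A), q.2) := by simp
    rw [this, map_smul, map_smul, smul_apply, smul_eq_mul, smul_eq_mul]
    ring
  rw [hqt] at ha ⊢
  rw [hB, norm_smul, mul_pow, Real.norm_eq_abs, sq_abs] at ha
  have := (abs_le.1 ha).1
  nlinarith [mul_le_mul_of_nonneg_left hb.le (sq_nonneg t)]

/-! ### Second order calculus -/

theorem hessQuad_congr {V : Type*} [NormedAddCommGroup V] [NormedSpace ℝ V] {φ ψ : V → ℝ} {u : V}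
    (h : φ =ᶠ[𝓝 u] ψ) (d : V) : hessQuad φ u d = hessQuad ψ u d := by
  unfold hessQuad
  rw [h.fderiv.fderiv_eq]

/-- At a critical point of `L` the second derivative of `u` does not contribute to the Hessian of
`L ∘ u`. -/
theorem hessQuad_comp_of_fderiv_eq_zero {E W : Type*} [NormedAddCommGroup E] [NormedSpace ℝ E]
    [NormedAddCommGroup W] [NormedSpace ℝ W] {L : W → ℝ} {u : E → W} {x : E}
    (hL : ContDiffAt ℝ 2 L (u x)) (hu : ContDiffAt ℝ 2 u x) (h0 : fderiv ℝ L (u x) = 0) (d : E) :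
    hessQuad (fun x' => L (u x')) x d = hessQuad L (u x) (fderiv ℝ u x d) := by
  have h1 : fderiv ℝ (fun x' => L (u x')) =ᶠ[𝓝 x]
      fun x' => (fderiv ℝ L (u x')).comp (fderiv ℝ u x') := by
    filter_upwards [hu.continuousAt.eventually (hL.eventually (by simp)),
      hu.eventually (by simp)] with x' hL' hu'
    exact fderiv_comp x' (hL'.differentiableAt (by simp)) (hu'.differentiableAt (by simp))
  have hL2 : HasFDerivAt (fderiv ℝ L) (fderiv ℝ (fderiv ℝ L) (u x)) (u x) :=
    ((hL.fderiv_right (m := 1) (by norm_num)).differentiableAt (by simp)).hasFDerivAt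
  have hu2 : HasFDerivAt (fderiv ℝ u) (fderiv ℝ (fderiv ℝ u) x) x :=
    ((hu.fderiv_right (m := 1) (by norm_num)).differentiableAt (by simp)).hasFDerivAt
  have hu1 : HasFDerivAt u (fderiv ℝ u x) x := (hu.differentiableAt (by simp)).hasFDerivAt
  have h2 := (hL2.comp x hu1).clm_comp hu2
  unfold hessQuad
  rw [h1.fderiv_eq]
  have h3 : fderiv ℝ (fun x' => (fderiv ℝ L (u x')).comp (fderiv ℝ u x')) x = _ := h2.fderiv
  rw [h3]
  simp [h0]

theorem exists_clm_pos {p : ℕ} {v : Euc p} (hv : v ≠ 0) :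
    ∃ l : Euc p →L[ℝ] ℝ, 0 < l v :=
  ⟨innerSL ℝ v, by simpa using pow_pos (norm_pos_iff.2 hv) 2⟩

/-- Second order sufficient optimality conditions, with a multiplier that may depend on the
critical direction, imply quadratic growth on the feasible set. -/
theorem exists_quadratic_growth {X : Type*} [NormedAddCommGroup X] [NormedSpace ℝ X]
    [FiniteDimensional ℝ X] {p q : ℕ} {φ : X → ℝ} {H : X → Euc p} {G : X → Euc q} {x₀ : X}
    (hφ : ContDiffAt ℝ 2 φ x₀) (hH : ContDiffAt ℝ 2 H x₀) (hG : ContDiffAt ℝ 2 G x₀)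
    (hH0 : H x₀ = 0)
    (hsosc : ∀ d : X, d ≠ 0 → fderiv ℝ H x₀ d = 0 →
      (∀ i, G x₀ i = 0 → fderiv ℝ (fun x => G x i) x₀ d ≤ 0) → fderiv ℝ φ x₀ d ≤ 0 →
      ∃ l : Euc p × Euc q,
        fderiv ℝ (fun x => φ x + inner ℝ l.1 (H x) + inner ℝ l.2 (G x)) x₀ = 0 ∧
        (∀ i, 0 ≤ l.2 i) ∧ inner ℝ l.2 (G x₀) = 0 ∧
        0 < hessQuad (fun x => φ x + inner ℝ l.1 (H x) + inner ℝ l.2 (G x)) x₀ d) :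
    ∃ γ : ℝ, 0 < γ ∧ ∀ᶠ x in 𝓝 x₀, H x = 0 → (∀ i, G x i ≤ 0) →
      φ x₀ + γ * ‖x - x₀‖ ^ 2 ≤ φ x := by
  have hφs := hφ.hasStrictFDerivAt (by simp)
  have hHs := hH.hasStrictFDerivAt (by simp)
  have hGs : ∀ i, HasStrictFDerivAt (fun x => G x i) (fderiv ℝ (fun x => G x i) x₀) x₀ :=
    fun i => ((contDiffAt_piLp (p := 2)).1 hG i).hasStrictFDerivAt (by simp)
  -- the growth constant is a variable tending to `0`, so that compactness makes it uniform
  suffices hmain : ∀ᶠ a : ℝ × X in 𝓝[>] 0 ×ˢ 𝓝 x₀, a.2 - x₀ ≠ 0 →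
      (H a.2 = 0 → (∀ i, G a.2 i ≤ 0) → φ x₀ + a.1 * ‖a.2 - x₀‖ ^ 2 ≤ φ a.2) by
    obtain ⟨γ, hγ, hγpos⟩ := (hmain.curry.and self_mem_nhdsWithin).exists
    refine ⟨γ, hγpos, ?_⟩
    filter_upwards [hγ] with x hx h1 h2
    by_cases hxx : x - x₀ = 0
    · simp [sub_eq_zero.1 hxx]
    · exact hx hxx h1 h2
  refine eventually_of_forall_direction fun d hd => ?_
  have hd0 : d ≠ 0 := fun h => by simp [h] at hd
  -- the pair `(x₀, x)` and the direction, as functions of `((γ, x), d)`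
  have hpair : Tendsto (fun b : (ℝ × X) × X => ((x₀, b.1.2), b.2))
      ((𝓝[>] 0 ×ˢ 𝓝 x₀) ×ˢ 𝓝 d) (𝓝 (x₀, x₀) ×ˢ 𝓝 d) := by
    refine Tendsto.prodMk ?_ tendsto_snd
    rw [nhds_prod_eq]
    exact Tendsto.prodMk tendsto_const_nhds (tendsto_snd.comp tendsto_fst)
  have hγ : ∀ c : ℝ, 0 < c → ∀ᶠ b : (ℝ × X) × X in (𝓝[>] 0 ×ˢ 𝓝 x₀) ×ˢ 𝓝 d,
      0 < b.1.1 ∧ b.1.1 < c := by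
    intro c hc
    have : ∀ᶠ γ : ℝ in 𝓝[>] 0, 0 < γ ∧ γ < c := Ioo_mem_nhdsGT hc
    exact (this.prod_inl _).prod_inl _
  -- near a direction that violates the linearized constraints there are no feasible points
  by_cases h1 : fderiv ℝ H x₀ d = 0
  swap
  · obtain ⟨l, hl⟩ := exists_clm_pos h1
    have hs : HasStrictFDerivAt (fun x => l (H x)) (l.comp (fderiv ℝ H x₀)) x₀ :=
      l.hasStrictFDerivAt.comp x₀ hHs
    filter_upwards [hpair.eventually (hs.eventually_mul_le_sub (d := d) (half_lt_self hl))]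
      with b hb hb0 hbd hbH
    have := hb _ (norm_nonneg _) hbd
    simp only [hbH, hH0, map_zero, sub_self] at this
    have hpos := mul_pos (half_pos hl) (norm_pos_iff.2 hb0)
    simp only [ContinuousLinearMap.comp_apply] at this hpos
    linarith
  by_cases h2 : ∀ i, G x₀ i = 0 → fderiv ℝ (fun x => G x i) x₀ d ≤ 0
  swap
  · push Not at h2
    obtain ⟨i, hi0, hi⟩ := h2
    filter_upwards [hpair.eventually ((hGs i).eventually_mul_le_sub (half_lt_self hi))]
      with b hb hb0 hbd _ hbG
    have := hb _ (norm_nonneg _) hbd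
    simp only [hi0] at this
    have hpos := mul_pos (half_pos hi) (norm_pos_iff.2 hb0)
    linarith [hbG i]
  -- near a direction of first order increase `φ` grows linearly
  by_cases h3 : fderiv ℝ φ x₀ d ≤ 0
  swap
  · push Not at h3
    have hsmall : ∀ᶠ b : (ℝ × X) × X in (𝓝[>] 0 ×ˢ 𝓝 x₀) ×ˢ 𝓝 d, ‖b.1.2 - x₀‖ < 1 := by
      have : ∀ᶠ x in 𝓝 x₀, ‖x - x₀‖ < 1 := by
        simp only [← dist_eq_norm]
        exact Metric.ball_mem_nhds x₀ one_pos
      exact (this.prod_inr _).prod_inl _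
    filter_upwards [hpair.eventually (hφs.eventually_mul_le_sub (half_lt_self h3)), hsmall,
      hγ _ (half_pos h3)] with b hb hb1 hbγ hb0 hbd _ _
    have := hb _ (norm_nonneg _) hbd
    have hn := norm_nonneg (b.1.2 - x₀)
    nlinarith [mul_nonneg hbγ.1.le hn, mul_nonneg (mul_nonneg hbγ.1.le hn) (sub_nonneg.2 hb1.le)]
  -- `d` is critical: on the feasible set `φ - φ x₀` dominates the increment of the Lagrangian for a
  -- multiplier adapted to `d`
  obtain ⟨l, hl0, hlpos, hlG, hlq⟩ := hsosc d hd0 h1 h2 h3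
  set L : X → ℝ := fun x => φ x + inner ℝ l.1 (H x) + inner ℝ l.2 (G x) with hLdef
  have hL : ContDiffAt ℝ 2 L x₀ :=
    (hφ.add (contDiffAt_const.inner ℝ hH)).add (contDiffAt_const.inner ℝ hG)
  -- the Taylor estimate needs a parameter space; the trivial one suffices here
  have hψ : HasStrictFDerivAt (fun w : PUnit.{1} × X => fderiv ℝ L w.2)
      ((fderiv ℝ (fderiv ℝ L) x₀).comp (ContinuousLinearMap.snd ℝ PUnit.{1} X))
      (PUnit.unit, x₀) :=
    ((hL.fderiv_right (m := 1) (by norm_num)).hasStrictFDerivAt (by simp)).comp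
      (PUnit.unit, x₀) hasStrictFDerivAt_snd
  have hφ' : ∀ᶠ w : PUnit.{1} × X in 𝓝 (PUnit.unit, x₀), HasFDerivAt L (fderiv ℝ L w.2) w.2 := by
    have : ∀ᶠ x in 𝓝 x₀, HasFDerivAt L (fderiv ℝ L x) x :=
      (hL.eventually (by simp)).mono fun x hx => (hx.differentiableAt (by simp)).hasFDerivAt
    exact (continuousAt_snd (p := (PUnit.unit.{1}, x₀))).eventually this
  have hq : 0 < hessQuad L x₀ d / 4 := by positivity
  -- a quarter of the quadratic form is strictly below its Taylor coefficient `1 / 2`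
  have htay := eventually_add_mul_sq_le (φ := fun _ : PUnit.{1} => L) (d := d)
    (c := hessQuad L x₀ d / 4) hφ' hψ (by
      change hessQuad L x₀ d / 4 < hessQuad L x₀ d / 2
      linarith)
  have htr : Tendsto (fun b : (ℝ × X) × X => ((PUnit.unit, x₀, b.1.2), b.2))
      ((𝓝[>] 0 ×ˢ 𝓝 x₀) ×ˢ 𝓝 d) (𝓝 (PUnit.unit.{1}, x₀, x₀) ×ˢ 𝓝 d) := by
    refine Tendsto.prodMk ?_ tendsto_snd
    rw [nhds_prod_eq, nhds_prod_eq]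
    exact Tendsto.prodMk tendsto_const_nhds
      (Tendsto.prodMk tendsto_const_nhds (tendsto_snd.comp tendsto_fst))
  filter_upwards [htr.eventually htay, hγ _ hq] with b hb hbγ hb0 hbd hbH hbG
  have h4 := hb _ hbd
  simp only [hl0, zero_apply, add_zero] at h4
  have h5 : inner ℝ l.2 (G b.1.2) ≤ 0 := by
    rw [PiLp.inner_apply]
    refine Finset.sum_nonpos fun i _ => ?_
    simpa using mul_nonpos_of_nonpos_of_nonneg (hbG i) (hlpos i)
  simp only [hLdef, hH0, hbH, hlG, inner_zero_right, add_zero] at h4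
  nlinarith [mul_le_mul_of_nonneg_right hbγ.2.le (sq_nonneg ‖b.1.2 - x₀‖)]

/-! ### Partial derivatives -/

/-- The partial derivative of `φ` in its second variable. -/
noncomputable def fderivSnd {n m : ℕ} {V : Type*} [NormedAddCommGroup V] [NormedSpace ℝ V]
    (φ : Euc n × Euc m → V) (w : Euc n × Euc m) : Euc m →L[ℝ] V :=
  fderiv ℝ (fun y => φ (w.1, y)) w.2

section Partial

variable {n m : ℕ} {V : Type*} [NormedAddCommGroup V] [NormedSpace ℝ V]
  {φ : Euc n × Euc m → V} {x : Euc n} {y : Euc m}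

theorem IsC2C3Snd.eventually {z : Euc n × Euc m} (h : IsC2C3Snd φ z) :
    ∀ᶠ w in 𝓝 z, IsC2C3Snd φ w :=
  (h.1.eventually (by simp)).and (h.2.eventually (by simp))

theorem IsC2C3Snd.contDiffAt_fderivSnd {z : Euc n × Euc m} (h : IsC2C3Snd φ z) :
    ContDiffAt ℝ 2 (fderivSnd φ) z := h.2

theorem IsC2C3Snd.differentiableAt {z : Euc n × Euc m} (h : IsC2C3Snd φ z) :
    DifferentiableAt ℝ φ z := h.1.differentiableAt (by simp)

theorem fderivSnd_apply (h : DifferentiableAt ℝ φ (x, y)) (d : Euc m) :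
    fderivSnd φ (x, y) d = fderiv ℝ φ (x, y) (0, d) := by
  have : HasFDerivAt (fun y' => φ (x, y')) _ y :=
    h.hasFDerivAt.comp y (hasFDerivAt_prodMk_right x y)
  unfold fderivSnd
  rw [this.fderiv]
  simp

theorem hasFDerivAt_fderivSnd (h : DifferentiableAt ℝ φ (x, y)) :
    HasFDerivAt (fun y' => φ (x, y')) (fderivSnd φ (x, y)) y :=
  (DifferentiableAt.comp y h (by fun_prop : DifferentiableAt ℝ (fun y' => (x, y')) y)).hasFDerivAt

theorem fderiv_fst_apply (h : DifferentiableAt ℝ φ (x, y)) (d : Euc n) :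
    fderiv ℝ (fun x' => φ (x', y)) x d = fderiv ℝ φ (x, y) (d, 0) := by
  have : HasFDerivAt (fun x' => φ (x', y)) _ x :=
    h.hasFDerivAt.comp x (hasFDerivAt_prodMk_left x y)
  rw [this.fderiv]
  simp

theorem fderiv_fst_add_fderiv_snd (h : DifferentiableAt ℝ φ (x, y)) (dx : Euc n) (dy : Euc m) :
    fderiv ℝ (fun x' => φ (x', y)) x dx + fderiv ℝ (fun y' => φ (x, y')) y dy =
      fderiv ℝ φ (x, y) (dx, dy) := by
  have h2 : fderiv ℝ (fun y' => φ (x, y')) y dy = fderiv ℝ φ (x, y) (0, dy) := fderivSnd_apply h dy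
  rw [fderiv_fst_apply h, h2, ← map_add]
  simp

theorem fderivSnd_coord {k : ℕ} {φ : Euc n × Euc m → Euc k} (h : DifferentiableAt ℝ φ (x, y))
    (i : Fin k) (d : Euc m) :
    fderiv ℝ (fun y' => φ (x, y') i) y d = fderivSnd φ (x, y) d i := by
  have := (EuclideanSpace.proj (𝕜 := ℝ) i).hasFDerivAt.comp y (hasFDerivAt_fderivSnd h)
  have h2 : HasFDerivAt (fun y' => φ (x, y') i) _ y := this
  rw [h2.fderiv]
  simp

end Partial

/-- The Riesz isomorphism from the dual of `ℝᵐ` to `ℝᵐ`, as a real linear map. -/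
noncomputable def gradOfDual (m : ℕ) : (Euc m →L[ℝ] ℝ) →L[ℝ] Euc m :=
  LinearMap.toContinuousLinearMap
    { toFun := fun l => (InnerProductSpace.toDual ℝ (Euc m)).symm l
      map_add' := fun a b => map_add _ a b
      map_smul' := fun c a => by simp }

theorem gradOfDual_apply {m : ℕ} (l : Euc m →L[ℝ] ℝ) :
    gradOfDual m l = (InnerProductSpace.toDual ℝ (Euc m)).symm l := rfl

theorem gradOfDual_eq_zero {m : ℕ} {l : Euc m →L[ℝ] ℝ} : gradOfDual m l = 0 ↔ l = 0 := by
  simp [gradOfDual_apply]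

theorem gradOfDual_innerSL_comp {m k : ℕ} (v : Euc k) (T : Euc m →L[ℝ] Euc k) :
    gradOfDual m ((innerSL ℝ v).comp T) = T.adjoint v := by
  refine ext_inner_right ℝ fun w => ?_
  rw [gradOfDual_apply, InnerProductSpace.toDual_symm_apply,
    ContinuousLinearMap.adjoint_inner_left]
  simp

/-! ### The projection onto the nonpositive orthant -/

/-- The coordinate projection of `ℝˢ` onto the coordinates where `w` is negative. At a `w` without
vanishing coordinates it is the derivative of the projection onto the nonpositive orthant. -/
noncomputable def negCoords {s : ℕ} (w : Euc s) : Euc s →L[ℝ] Euc s :=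
  LinearMap.toContinuousLinearMap
    { toFun := fun v => WithLp.toLp 2 (fun i => if w i < 0 then v i else 0)
      map_add' := fun a b => by ext i; by_cases h : w i < 0 <;> simp [h]
      map_smul' := fun c a => by ext i; by_cases h : w i < 0 <;> simp [h] }

theorem negCoords_apply {s : ℕ} (w v : Euc s) (i : Fin s) :
    negCoords w v i = if w i < 0 then v i else 0 := rfl

theorem projNonpos_eventuallyEq {s : ℕ} {w : Euc s} (hw : ∀ i, w i ≠ 0) :
    projNonpos =ᶠ[𝓝 w] negCoords w := by
  have : ∀ᶠ v in 𝓝 w, ∀ i, (w i < 0 → v i < 0) ∧ (0 < w i → 0 < v i) := by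
    refine eventually_all.2 fun i => ?_
    have hc : ContinuousAt (fun v : Euc s => v i) w := by fun_prop
    rcases lt_or_gt_of_ne (hw i) with h | h
    · filter_upwards [hc.eventually (gt_mem_nhds h)] with v hv
      exact ⟨fun _ => hv, fun h' => absurd h' h.not_gt⟩
    · filter_upwards [hc.eventually (lt_mem_nhds h)] with v hv
      exact ⟨fun h' => absurd h' h.not_gt, fun _ => hv⟩
  filter_upwards [this] with v hv
  ext i
  rw [negCoords_apply]
  change min (v i) 0 = _
  rcases lt_or_gt_of_ne (hw i) with h | h
  · rw [if_pos h, min_eq_left ((hv i).1 h).le]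
  · rw [if_neg h.not_gt, min_eq_right ((hv i).2 h).le]

theorem hasFDerivAt_projNonpos {s : ℕ} {w : Euc s} (hw : ∀ i, w i ≠ 0) :
    HasFDerivAt projNonpos (negCoords w) w :=
  (negCoords w).hasFDerivAt.congr_of_eventuallyEq (projNonpos_eventuallyEq hw)

theorem contDiffAt_projNonpos {s : ℕ} {w : Euc s} (hw : ∀ i, w i ≠ 0) {k : ℕ∞} :
    ContDiffAt ℝ k projNonpos w :=
  (negCoords w).contDiff.contDiffAt.congr_of_eventuallyEq (projNonpos_eventuallyEq hw)

theorem sub_projNonpos_eq_zero_iff {s : ℕ} {a b : Euc s} :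
    a - projNonpos (a + b) = 0 ↔ ∀ i, a i ≤ 0 ∧ 0 ≤ b i ∧ b i * a i = 0 := by
  have h1 : a - projNonpos (a + b) = 0 ↔ ∀ i, a i = min (a i + b i) 0 := by
    rw [sub_eq_zero]
    exact ⟨fun h i => congrArg (fun v : Euc s => v i) h, fun h => by ext i; exact h i⟩
  rw [h1]
  refine forall_congr' fun i => ⟨fun h => ?_, fun ⟨ha, hb, hab⟩ => ?_⟩
  · rcases min_cases (a i + b i) 0 with ⟨h2, h3⟩ | ⟨h2, h3⟩
    · rw [h2] at h
      have hb : b i = 0 := by linarith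
      rw [hb] at h3 ⊢
      simpa using h3
    · rw [h2] at h
      rw [h] at h3 ⊢
      simpa using h3.le
  · rcases mul_eq_zero.1 hab with h0 | h0
    · rw [h0, add_zero, min_eq_left ha]
    · rw [h0, zero_add, min_eq_right hb]

theorem inner_eq_zero_iff_of_nonneg_of_nonpos {s : ℕ} {a b : Euc s} (ha : ∀ i, a i ≤ 0)
    (hb : ∀ i, 0 ≤ b i) : inner ℝ b a = 0 ↔ ∀ i, b i * a i = 0 := by
  have h1 : inner ℝ b a = ∑ i, b i * a i := by
    rw [PiLp.inner_apply]
    exact Finset.sum_congr rfl fun i _ => by simp [mul_comm]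
  rw [h1, Finset.sum_eq_zero_iff_of_nonpos
    fun i _ => mul_nonpos_of_nonneg_of_nonpos (hb i) (ha i)]
  simp

namespace BilevelProgram

variable {n m p q r s : ℕ} (P : BilevelProgram n m p q r s)

/-! ### The derivative of the lower level Lagrangian -/

/-- The lower level data have the smoothness required of them at `z`. -/
structure LowerSmoothAt (z : Euc n × Euc m) : Prop where
  f : IsC2C3Snd P.f z
  g : IsC2C3Snd P.g z
  h : IsC2C3Snd P.h z

/-- The derivative `D_y ℒ` of the lower level Lagrangian as a function of `u = (x, y, μ, ξ)`. -/
noncomputable def lagDeriv (u : Euc n × Euc m × Euc r × Euc s) : Euc m →L[ℝ] ℝ :=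
  fderivSnd P.f (u.1, u.2.1) + (innerSL ℝ u.2.2.1).comp (fderivSnd P.h (u.1, u.2.1)) +
    (innerSL ℝ u.2.2.2).comp (fderivSnd P.g (u.1, u.2.1))

variable {P} {x : Euc n} {y : Euc m} {μ : Euc r} {ξ : Euc s}

theorem LowerSmoothAt.eventually {z : Euc n × Euc m} (hP : P.LowerSmoothAt z) :
    ∀ᶠ w in 𝓝 z, P.LowerSmoothAt w := by
  filter_upwards [hP.f.eventually, hP.g.eventually, hP.h.eventually] with w h1 h2 h3
  exact ⟨h1, h2, h3⟩

theorem tendsto_pair {u : Euc n × Euc m × Euc r × Euc s} :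
    Tendsto (fun u : Euc n × Euc m × Euc r × Euc s => (u.1, u.2.1)) (𝓝 u) (𝓝 (u.1, u.2.1)) :=
  Continuous.tendsto (by fun_prop) u

theorem hasFDerivAt_lowerLagrangian (hP : P.LowerSmoothAt (x, y)) (μ : Euc r) (ξ : Euc s) :
    HasFDerivAt (fun y' => P.lowerLagrangian x y' μ ξ) (P.lagDeriv (x, y, μ, ξ)) y :=
  ((hasFDerivAt_fderivSnd hP.f.differentiableAt).add
    ((innerSL ℝ μ).hasFDerivAt.comp y (hasFDerivAt_fderivSnd hP.h.differentiableAt))).add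
    ((innerSL ℝ ξ).hasFDerivAt.comp y (hasFDerivAt_fderivSnd hP.g.differentiableAt))

theorem gradYLagrangian_eq (hP : P.LowerSmoothAt (x, y)) (μ : Euc r) (ξ : Euc s) :
    P.gradYLagrangian x y μ ξ = gradOfDual m (P.lagDeriv (x, y, μ, ξ)) := by
  unfold gradYLagrangian gradient
  rw [(hasFDerivAt_lowerLagrangian hP μ ξ).fderiv]
  rfl

theorem contDiffAt_lagDeriv (hP : P.LowerSmoothAt (x, y)) :
    ContDiffAt ℝ 2 P.lagDeriv (x, y, μ, ξ) := by
  have hz : ContDiffAt ℝ 2 (fun u : Euc n × Euc m × Euc r × Euc s => (u.1, u.2.1))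
      (x, y, μ, ξ) := by fun_prop
  have h1 := ContDiffAt.comp (x, y, μ, ξ) hP.f.contDiffAt_fderivSnd hz
  have h2 := ContDiffAt.comp (x, y, μ, ξ) hP.h.contDiffAt_fderivSnd hz
  have h3 := ContDiffAt.comp (x, y, μ, ξ) hP.g.contDiffAt_fderivSnd hz
  have h4 : ContDiffAt ℝ 2 (fun u : Euc n × Euc m × Euc r × Euc s => innerSL ℝ u.2.2.1)
      (x, y, μ, ξ) := (innerSL ℝ).contDiff.contDiffAt.comp _ (by fun_prop)
  have h5 : ContDiffAt ℝ 2 (fun u : Euc n × Euc m × Euc r × Euc s => innerSL ℝ u.2.2.2)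
      (x, y, μ, ξ) := (innerSL ℝ).contDiff.contDiffAt.comp _ (by fun_prop)
  exact (h1.add (h4.clm_comp h2)).add (h5.clm_comp h3)

/-- The derivative of `D_y ℒ` is affine in the multipliers. -/
theorem fderiv_lagDeriv_multipliers (hP : P.LowerSmoothAt (x, y)) (dμ : Euc r) (dξ : Euc s) :
    fderiv ℝ P.lagDeriv (x, y, μ, ξ) (0, 0, dμ, dξ) =
      (innerSL ℝ dμ).comp (fderivSnd P.h (x, y)) + (innerSL ℝ dξ).comp (fderivSnd P.g (x, y)) := by
  have hd := ((contDiffAt_lagDeriv (μ := μ) (ξ := ξ) hP).differentiableAt (by simp)).hasFDerivAt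
  have hl : HasFDerivAt (fun v : Euc r × Euc s => (x, y, v))
      ((ContinuousLinearMap.inr ℝ (Euc n) (Euc m × Euc r × Euc s)).comp
        (ContinuousLinearMap.inr ℝ (Euc m) (Euc r × Euc s))) (μ, ξ) :=
    (hasFDerivAt_prodMk_right x (y, μ, ξ)).comp (μ, ξ) (hasFDerivAt_prodMk_right y (μ, ξ))
  have h1 := hd.comp (μ, ξ) hl
  have hμ : HasFDerivAt (fun v : Euc r × Euc s => (innerSL ℝ v.1).comp (fderivSnd P.h (x, y)))
      _ (μ, ξ) :=
    ((((ContinuousLinearMap.compL ℝ (Euc m) (Euc r) ℝ).flip (fderivSnd P.h (x, y))).comp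
      (innerSL ℝ)).comp (ContinuousLinearMap.fst ℝ (Euc r) (Euc s))).hasFDerivAt
  have hξ : HasFDerivAt (fun v : Euc r × Euc s => (innerSL ℝ v.2).comp (fderivSnd P.g (x, y)))
      _ (μ, ξ) :=
    ((((ContinuousLinearMap.compL ℝ (Euc m) (Euc s) ℝ).flip (fderivSnd P.g (x, y))).comp
      (innerSL ℝ)).comp (ContinuousLinearMap.snd ℝ (Euc r) (Euc s))).hasFDerivAt
  have h2 := (((hasFDerivAt_const (fderivSnd P.f (x, y)) (μ, ξ)).add hμ).add hξ)
  have h3 := h1.unique h2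
  have := DFunLike.congr_fun h3 (dμ, dξ)
  simpa using this

theorem hessQuad_lowerLagrangian (hP : P.LowerSmoothAt (x, y)) (d : Euc m) :
    hessQuad (fun y' => P.lowerLagrangian x y' μ ξ) y d =
      fderiv ℝ P.lagDeriv (x, y, μ, ξ) (0, d, 0, 0) d := by
  have h1 : fderiv ℝ (fun y' => P.lowerLagrangian x y' μ ξ) =ᶠ[𝓝 y]
      fun y' => P.lagDeriv (x, y', μ, ξ) := by
    have hc : ContinuousAt (fun y' : Euc m => (x, y')) y := by fun_prop
    filter_upwards [hc.eventually hP.eventually] with y' hy'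
    exact (hasFDerivAt_lowerLagrangian hy' μ ξ).fderiv
  have hd := ((contDiffAt_lagDeriv (μ := μ) (ξ := ξ) hP).differentiableAt (by simp)).hasFDerivAt
  have hl : HasFDerivAt (fun y' : Euc m => (x, y', μ, ξ))
      ((ContinuousLinearMap.inr ℝ (Euc n) (Euc m × Euc r × Euc s)).comp
        (ContinuousLinearMap.inl ℝ (Euc m) (Euc r × Euc s))) y :=
    (hasFDerivAt_prodMk_right x (y, μ, ξ)).comp y (hasFDerivAt_prodMk_left y (μ, ξ))
  have h2 : HasFDerivAt (fun y' => P.lagDeriv (x, y', μ, ξ)) _ y :=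
    HasFDerivAt.comp (g := P.lagDeriv) (f := fun y' : Euc m => (x, y', μ, ξ)) y hd hl
  unfold hessQuad
  rw [h1.fderiv_eq, h2.fderiv]
  simp
  rfl

end BilevelProgram

namespace BilevelProgram

/-! ### The Karush-Kuhn-Tucker map of the lower level problem -/

/-- The map `u = (x, y, μ, ξ) ↦ (∇_y ℒ, h, g - Π(g + ξ))` whose zeros are the Karush-Kuhn-Tucker
points of the lower level problems. -/
noncomputable def kktMap {n m p q r s : ℕ} (P : BilevelProgram n m p q r s)
    (u : Euc n × Euc m × Euc r × Euc s) : Euc m × Euc r × Euc s :=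
  (P.gradYLagrangian u.1 u.2.1 u.2.2.1 u.2.2.2, P.h (u.1, u.2.1),
    P.g (u.1, u.2.1) - projNonpos (P.g (u.1, u.2.1) + u.2.2.2))

variable {n m p q r s : ℕ} {P : BilevelProgram n m p q r s}
  {x : Euc n} {y : Euc m} {μ : Euc r} {ξ : Euc s}

theorem JacobianUniqueness.complementary_apply (hJ : P.JacobianUniqueness x y μ ξ) (i : Fin s) :
    ξ i * P.g (x, y) i = 0 :=
  (inner_eq_zero_iff_of_nonneg_of_nonpos hJ.ineq_feasible hJ.multiplier_nonneg).1
    hJ.complementary i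

theorem JacobianUniqueness.kktMap_eq_zero (hJ : P.JacobianUniqueness x y μ ξ) :
    P.kktMap (x, y, μ, ξ) = 0 :=
  Prod.ext hJ.stationary (Prod.ext hJ.eq_feasible (sub_projNonpos_eq_zero_iff.2
    fun i => ⟨hJ.ineq_feasible i, hJ.multiplier_nonneg i, hJ.complementary_apply i⟩))

/-- Strict complementarity keeps `g + ξ` away from the kinks of the projection. -/
theorem JacobianUniqueness.add_ne_zero (hJ : P.JacobianUniqueness x y μ ξ) (i : Fin s) :
    (P.g (x, y) + ξ) i ≠ 0 := by
  intro h
  have h1 := hJ.complementary_apply i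
  have h2 := hJ.strict i
  rw [PiLp.add_apply] at h
  rcases mul_eq_zero.1 h1 with h3 | h3 <;> linarith

theorem JacobianUniqueness.multiplier_pos (hJ : P.JacobianUniqueness x y μ ξ) {i : Fin s}
    (hi : P.g (x, y) i = 0) : 0 < ξ i := by
  simpa [hi] using hJ.strict i

theorem JacobianUniqueness.multiplier_eq_zero (hJ : P.JacobianUniqueness x y μ ξ) {i : Fin s}
    (hi : P.g (x, y) i ≠ 0) : ξ i = 0 :=
  (mul_eq_zero.1 (hJ.complementary_apply i)).resolve_right hi

theorem JacobianUniqueness.add_neg_iff (hJ : P.JacobianUniqueness x y μ ξ) (i : Fin s) :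
    (P.g (x, y) + ξ) i < 0 ↔ P.g (x, y) i ≠ 0 := by
  rw [PiLp.add_apply]
  refine ⟨fun h h0 => ?_, fun h => ?_⟩
  · rw [h0, zero_add] at h
    exact absurd h (hJ.multiplier_nonneg i).not_gt
  · rw [hJ.multiplier_eq_zero h, add_zero]
    exact lt_of_le_of_ne (hJ.ineq_feasible i) h

theorem contDiffAt_gradYLagrangian (hP : P.LowerSmoothAt (x, y)) :
    ContDiffAt ℝ 2 (fun u : Euc n × Euc m × Euc r × Euc s =>
      P.gradYLagrangian u.1 u.2.1 u.2.2.1 u.2.2.2) (x, y, μ, ξ) := by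
  have h1 : ContDiffAt ℝ 2 (fun u => gradOfDual m (P.lagDeriv u)) (x, y, μ, ξ) :=
    (gradOfDual m).contDiff.contDiffAt.comp _ (contDiffAt_lagDeriv hP)
  refine h1.congr_of_eventuallyEq ?_
  filter_upwards [tendsto_pair.eventually hP.eventually] with u hu
  exact gradYLagrangian_eq hu _ _

theorem hasFDerivAt_gradYLagrangian (hP : P.LowerSmoothAt (x, y)) :
    HasFDerivAt (fun u : Euc n × Euc m × Euc r × Euc s =>
      P.gradYLagrangian u.1 u.2.1 u.2.2.1 u.2.2.2)
      ((gradOfDual m).comp (fderiv ℝ P.lagDeriv (x, y, μ, ξ))) (x, y, μ, ξ) := by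
  have h1 : HasFDerivAt (fun u => gradOfDual m (P.lagDeriv u)) _ (x, y, μ, ξ) :=
    (gradOfDual m).hasFDerivAt.comp (x, y, μ, ξ)
      ((contDiffAt_lagDeriv (μ := μ) (ξ := ξ) hP).differentiableAt (by simp)).hasFDerivAt
  refine h1.congr_of_eventuallyEq ?_
  filter_upwards [tendsto_pair.eventually hP.eventually] with u hu
  exact gradYLagrangian_eq hu _ _

theorem contDiffAt_kktMap (hP : P.LowerSmoothAt (x, y)) (hw : ∀ i, (P.g (x, y) + ξ) i ≠ 0) :
    ContDiffAt ℝ 2 P.kktMap (x, y, μ, ξ) := by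
  have hz : ContDiffAt ℝ 2 (fun u : Euc n × Euc m × Euc r × Euc s => (u.1, u.2.1))
      (x, y, μ, ξ) := by fun_prop
  have hh := ContDiffAt.comp (x, y, μ, ξ) hP.h.1 hz
  have hg := ContDiffAt.comp (x, y, μ, ξ) hP.g.1 hz
  have hξ : ContDiffAt ℝ 2 (fun u : Euc n × Euc m × Euc r × Euc s => u.2.2.2) (x, y, μ, ξ) := by
    fun_prop
  have hproj := ContDiffAt.comp (x, y, μ, ξ) (contDiffAt_projNonpos hw (k := 2)) (hg.add hξ)
  exact (contDiffAt_gradYLagrangian hP).prodMk (hh.prodMk (hg.sub hproj))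

set_option synthInstance.maxHeartbeats 200000 in
theorem fderiv_kktMap_apply (hP : P.LowerSmoothAt (x, y)) (hw : ∀ i, (P.g (x, y) + ξ) i ≠ 0)
    (dx : Euc n) (dy : Euc m) (dμ : Euc r) (dξ : Euc s) :
    fderiv ℝ P.kktMap (x, y, μ, ξ) (dx, dy, dμ, dξ) =
      (gradOfDual m (fderiv ℝ P.lagDeriv (x, y, μ, ξ) (dx, dy, dμ, dξ)),
        fderiv ℝ P.h (x, y) (dx, dy),
        fderiv ℝ P.g (x, y) (dx, dy) -
          negCoords (P.g (x, y) + ξ) (fderiv ℝ P.g (x, y) (dx, dy) + dξ)) := by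
  have hz : HasFDerivAt (fun u : Euc n × Euc m × Euc r × Euc s => (u.1, u.2.1))
      _ (x, y, μ, ξ) :=
    ((ContinuousLinearMap.fst ℝ (Euc n) (Euc m × Euc r × Euc s)).prod
      ((ContinuousLinearMap.fst ℝ (Euc m) (Euc r × Euc s)).comp
        (ContinuousLinearMap.snd ℝ (Euc n) (Euc m × Euc r × Euc s)))).hasFDerivAt
  have hξ : HasFDerivAt (fun u : Euc n × Euc m × Euc r × Euc s => u.2.2.2)
      _ (x, y, μ, ξ) :=
    ((ContinuousLinearMap.snd ℝ (Euc r) (Euc s)).comp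
      ((ContinuousLinearMap.snd ℝ (Euc m) (Euc r × Euc s)).comp
        (ContinuousLinearMap.snd ℝ (Euc n) (Euc m × Euc r × Euc s)))).hasFDerivAt
  have hh := HasFDerivAt.comp (x, y, μ, ξ) hP.h.differentiableAt.hasFDerivAt hz
  have hg := HasFDerivAt.comp (x, y, μ, ξ) hP.g.differentiableAt.hasFDerivAt hz
  have hproj := HasFDerivAt.comp (x, y, μ, ξ) (hasFDerivAt_projNonpos hw) (hg.add hξ)
  have h : HasFDerivAt P.kktMap _ (x, y, μ, ξ) :=
    (hasFDerivAt_gradYLagrangian hP).prodMk (hh.prodMk (hg.sub hproj))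
  rw [h.fderiv]
  rfl

theorem lagDeriv_eq_zero (hP : P.LowerSmoothAt (x, y)) (h : P.gradYLagrangian x y μ ξ = 0) :
    P.lagDeriv (x, y, μ, ξ) = 0 := by
  rwa [gradYLagrangian_eq hP, gradOfDual_eq_zero] at h

/-- At a Karush-Kuhn-Tucker point every direction annihilated by the active constraint gradients is
critical. -/
theorem JacobianUniqueness.mem_lowerCriticalCone (hJ : P.JacobianUniqueness x y μ ξ)
    (hP : P.LowerSmoothAt (x, y)) {d : Euc m} (hh : fderivSnd P.h (x, y) d = 0)
    (hg : ∀ i, P.g (x, y) i = 0 → fderivSnd P.g (x, y) d i = 0) :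
    d ∈ P.lowerCriticalCone x y := by
  refine ⟨hh, fun i hi => ?_, ?_⟩
  · rw [fderivSnd_coord hP.g.differentiableAt, hg i hi]
  · have h1 := DFunLike.congr_fun (lagDeriv_eq_zero hP hJ.stationary) d
    have h2 : inner ℝ ξ (fderivSnd P.g (x, y) d) = 0 := by
      rw [PiLp.inner_apply]
      refine Finset.sum_eq_zero fun i _ => ?_
      by_cases hi : P.g (x, y) i = 0
      · simp [hg i hi]
      · simp [hJ.multiplier_eq_zero hi]
    have h3 : fderivSnd P.f (x, y) d = 0 := by
      simpa [lagDeriv, hh, h2] using h1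
    exact h3.le

theorem gradient_coord {k : ℕ} {φ : Euc n × Euc m → Euc k} (h : DifferentiableAt ℝ φ (x, y))
    (i : Fin k) :
    gradient (fun y' => φ (x, y') i) y =
      (fderivSnd φ (x, y)).adjoint (EuclideanSpace.single i 1) := by
  refine ext_inner_right ℝ fun d => ?_
  rw [gradient, InnerProductSpace.toDual_symm_apply, fderivSnd_coord h,
    ContinuousLinearMap.adjoint_inner_left, EuclideanSpace.inner_single_left]
  simp

/-- The linear independence constraint qualification, as injectivity of the adjoint of the active
Jacobian. -/
theorem JacobianUniqueness.multipliers_eq_zero (hJ : P.JacobianUniqueness x y μ ξ)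
    (hP : P.LowerSmoothAt (x, y)) {a : Euc r} {b : Euc s}
    (hb : ∀ i, P.g (x, y) i ≠ 0 → b i = 0)
    (hab : (fderivSnd P.h (x, y)).adjoint a + (fderivSnd P.g (x, y)).adjoint b = 0) :
    a = 0 ∧ b = 0 := by
  classical
  have hdec : ∀ {k : ℕ} (φ : Euc n × Euc m → Euc k) (_ : DifferentiableAt ℝ φ (x, y)) (c : Euc k),
      (fderivSnd φ (x, y)).adjoint c = ∑ i, c i • gradient (fun y' => φ (x, y') i) y := by
    intro k φ hφ c
    have hc : c = ∑ i, c i • EuclideanSpace.single i (1 : ℝ) := by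
      ext j
      simp [Pi.single_apply]
    conv_lhs => rw [hc]
    rw [map_sum]
    refine Finset.sum_congr rfl fun i _ => ?_
    rw [map_smul, gradient_coord hφ]
  rw [hdec P.h hP.h.differentiableAt, hdec P.g hP.g.differentiableAt] at hab
  have hsub : ∑ i, b i • gradient (fun y' => P.g (x, y') i) y =
      ∑ i : {i : Fin s // P.g (x, y) i = 0}, b i.1 • gradient (fun y' => P.g (x, y') i.1) y := by
    rw [← Finset.sum_filter_of_ne (p := fun i => P.g (x, y) i = 0)]
    · exact Finset.sum_subtype _ (by simp) fun i => b i • gradient (fun y' => P.g (x, y') i) y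
    · intro i _ hne
      by_contra hi
      exact hne (by rw [hb i hi, zero_smul])
  have hli := Fintype.linearIndependent_iff.1 hJ.licq
    (Sum.elim (fun j => a j) (fun i => b i.1)) (by
      rw [Fintype.sum_sum_type]
      simpa [hsub] using hab)
  refine ⟨by ext j; simpa using hli (Sum.inl j), ?_⟩
  ext i
  by_cases hi : P.g (x, y) i = 0
  · simpa using hli (Sum.inr ⟨i, hi⟩)
  · simpa using hb i hi

/-- The partial derivative of the KKT map in `(y, μ, ξ)` is invertible where the Jacobian
uniqueness conditions hold. -/
theorem JacobianUniqueness.isInvertible (hJ : P.JacobianUniqueness x y μ ξ)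
    (hP : P.LowerSmoothAt (x, y)) :
    (fderiv ℝ P.kktMap (x, y, μ, ξ) ∘L
      ContinuousLinearMap.inr ℝ (Euc n) (Euc m × Euc r × Euc s)).IsInvertible := by
  set T := fderiv ℝ P.kktMap (x, y, μ, ξ) ∘L
      ContinuousLinearMap.inr ℝ (Euc n) (Euc m × Euc r × Euc s) with hT
  have hinj : Function.Injective T := by
    refine (injective_iff_map_eq_zero T).2 ?_
    rintro ⟨dy, dμ, dξ⟩ h
    rw [hT, ContinuousLinearMap.comp_apply, ContinuousLinearMap.inr_apply,
      fderiv_kktMap_apply hP hJ.add_ne_zero, Prod.mk_eq_zero, Prod.mk_eq_zero] at h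
    obtain ⟨h1, h2, h3⟩ := h
    rw [← fderivSnd_apply hP.h.differentiableAt] at h2
    rw [← fderivSnd_apply hP.g.differentiableAt] at h3
    -- the third block fixes `dy` on the active constraints and `dξ` on the inactive ones
    have h3' : ∀ i, (P.g (x, y) i = 0 → fderivSnd P.g (x, y) dy i = 0) ∧
        (P.g (x, y) i ≠ 0 → dξ i = 0) := by
      intro i
      have h4 : fderivSnd P.g (x, y) dy i -
          (if (P.g (x, y) + ξ) i < 0 then fderivSnd P.g (x, y) dy i + dξ i else 0) = 0 :=
        congrArg (fun v : Euc s => v i) h3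
      constructor
      · intro hi
        rwa [if_neg (fun h => (hJ.add_neg_iff i).1 h hi), sub_zero] at h4
      · intro hi
        rw [if_pos ((hJ.add_neg_iff i).2 hi)] at h4
        linarith
    have hsplit : fderiv ℝ P.lagDeriv (x, y, μ, ξ) (0, dy, dμ, dξ) =
        fderiv ℝ P.lagDeriv (x, y, μ, ξ) (0, dy, 0, 0) +
          ((innerSL ℝ dμ).comp (fderivSnd P.h (x, y)) +
            (innerSL ℝ dξ).comp (fderivSnd P.g (x, y))) := by
      rw [← fderiv_lagDeriv_multipliers hP, ← map_add]
      simp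
    rw [gradOfDual_eq_zero, hsplit] at h1
    -- testing the first block with `dy` leaves only the Hessian term
    have hdy : dy = 0 := by
      by_contra hne
      have hpos := hJ.sosc dy
        (hJ.mem_lowerCriticalCone hP h2 fun i hi => (h3' i).1 hi) hne
      rw [hessQuad_lowerLagrangian hP] at hpos
      have h5 := DFunLike.congr_fun h1 dy
      have h6 : inner ℝ dξ (fderivSnd P.g (x, y) dy) = 0 := by
        rw [PiLp.inner_apply]
        refine Finset.sum_eq_zero fun i _ => ?_
        by_cases hi : P.g (x, y) i = 0
        · simp [(h3' i).1 hi]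
        · simp [(h3' i).2 hi]
      simp only [add_apply, ContinuousLinearMap.comp_apply, innerSL_apply_apply, h2, h6,
        inner_zero_right, add_zero, zero_apply] at h5
      exact hpos.ne' h5
    subst hdy
    have h7 : fderiv ℝ P.lagDeriv (x, y, μ, ξ) (0, 0, 0, 0) = 0 := map_zero _
    rw [h7, zero_add] at h1
    have h8 := congrArg (gradOfDual m) h1
    rw [map_add, gradOfDual_innerSL_comp, gradOfDual_innerSL_comp, map_zero] at h8
    obtain ⟨ha, hb⟩ := hJ.multipliers_eq_zero hP (fun i hi => (h3' i).2 hi) h8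
    rw [ha, hb]
    rfl
  exact ⟨(LinearEquiv.ofInjectiveEndo (T : _ →ₗ[ℝ] _) hinj).toContinuousLinearEquiv,
    ContinuousLinearMap.ext fun v => rfl⟩

end BilevelProgram

namespace BilevelProgram

variable {n m p q r s : ℕ} {P : BilevelProgram n m p q r s}
  {x : Euc n} {y : Euc m} {μ : Euc r} {ξ : Euc s}

/-! ### Stability of the Jacobian uniqueness conditions -/

theorem continuousAt_fderivSnd {V : Type*} [NormedAddCommGroup V] [NormedSpace ℝ V]
    {φ : Euc n × Euc m → V} (hφ : IsC2C3Snd φ (x, y)) :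
    ContinuousAt (fun u : Euc n × Euc m × Euc r × Euc s => fderivSnd φ (u.1, u.2.1))
      (x, y, μ, ξ) :=
  ContinuousAt.comp (f := fun u : Euc n × Euc m × Euc r × Euc s => (u.1, u.2.1))
    (x := (x, y, μ, ξ)) hφ.contDiffAt_fderivSnd.continuousAt (by fun_prop)

theorem continuousAt_comp_pair {V : Type*} [NormedAddCommGroup V] [NormedSpace ℝ V]
    {φ : Euc n × Euc m → V} (hφ : IsC2C3Snd φ (x, y)) :
    ContinuousAt (fun u : Euc n × Euc m × Euc r × Euc s => φ (u.1, u.2.1)) (x, y, μ, ξ) :=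
  ContinuousAt.comp (f := fun u : Euc n × Euc m × Euc r × Euc s => (u.1, u.2.1))
    (x := (x, y, μ, ξ)) hφ.1.continuousAt (by fun_prop)

theorem JacobianUniqueness.eventually_licq (hJ : P.JacobianUniqueness x y μ ξ)
    (hP : P.LowerSmoothAt (x, y)) :
    ∀ᶠ u : Euc n × Euc m × Euc r × Euc s in 𝓝 (x, y, μ, ξ),
      LinearIndependent ℝ
        (Sum.elim (fun j : Fin r => gradient (fun y' => P.h (u.1, y') j) u.2.1)
          (fun i : {i : Fin s // P.g (x, y) i = 0} =>
            gradient (fun y' => P.g (u.1, y') i.1) u.2.1)) := by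
  set Γ : Euc n × Euc m × Euc r × Euc s → Fin r ⊕ {i : Fin s // P.g (x, y) i = 0} → Euc m :=
    fun u => Sum.elim
      (fun j => (fderivSnd P.h (u.1, u.2.1)).adjoint (EuclideanSpace.single j 1))
      (fun i => (fderivSnd P.g (u.1, u.2.1)).adjoint (EuclideanSpace.single i.1 1)) with hΓ
  have hcont : ContinuousAt Γ (x, y, μ, ξ) := by
    refine continuousAt_pi.2 fun k => ?_
    rcases k with j | i
    · exact (ContinuousLinearMap.adjoint.continuous.continuousAt.comp
        (continuousAt_fderivSnd hP.h)).clm_apply continuousAt_const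
    · exact (ContinuousLinearMap.adjoint.continuous.continuousAt.comp
        (continuousAt_fderivSnd hP.g)).clm_apply continuousAt_const
  have h0 : LinearIndependent ℝ (Γ (x, y, μ, ξ)) := by
    have := hJ.licq
    simp only [gradient_coord hP.h.differentiableAt, gradient_coord hP.g.differentiableAt] at this
    exact this
  filter_upwards [hcont.eventually
    ((isOpen_setOfPred_linearIndependent (𝕜 := ℝ) (E := Euc m)
      (ι := Fin r ⊕ {i : Fin s // P.g (x, y) i = 0})).mem_nhds h0),
    tendsto_pair.eventually hP.eventually] with u hu hPu
  simp only [gradient_coord hPu.h.differentiableAt, gradient_coord hPu.g.differentiableAt]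
  exact hu

theorem continuousAt_lagHess (hP : P.LowerSmoothAt (x, y)) (d : Euc m) :
    ContinuousAt (fun v : (Euc n × Euc m × Euc r × Euc s) × Euc m =>
      fderiv ℝ P.lagDeriv v.1 (0, v.2, 0, 0) v.2) ((x, y, μ, ξ), d) := by
  have h1 : ContinuousAt (fderiv ℝ P.lagDeriv) (x, y, μ, ξ) :=
    ((contDiffAt_lagDeriv hP).fderiv_right (m := 1) (by norm_num)).continuousAt
  have h2 : ContinuousAt (fun v : (Euc n × Euc m × Euc r × Euc s) × Euc m =>
      fderiv ℝ P.lagDeriv v.1) ((x, y, μ, ξ), d) :=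
    ContinuousAt.comp (f := Prod.fst) (x := ((x, y, μ, ξ), d)) h1 continuousAt_fst
  exact (h2.clm_apply (by fun_prop)).clm_apply continuousAt_snd

/-- Stability of the second order sufficient condition: an active constraint of the reference point
stays active, so that the critical cones are upper semicontinuous, and the unit sphere is
compact. -/
theorem JacobianUniqueness.eventually_sosc (hJ : P.JacobianUniqueness x y μ ξ)
    (hP : P.LowerSmoothAt (x, y)) :
    ∀ᶠ u : Euc n × Euc m × Euc r × Euc s in 𝓝 (x, y, μ, ξ),
      (∀ i, P.g (x, y) i = 0 → P.g (u.1, u.2.1) i = 0) →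
      ∀ d ∈ P.lowerCriticalCone u.1 u.2.1, d ≠ 0 →
        0 < hessQuad (fun y' => P.lowerLagrangian u.1 y' u.2.2.1 u.2.2.2) u.2.1 d := by
  have key : ∀ᶠ u : Euc n × Euc m × Euc r × Euc s in 𝓝 (x, y, μ, ξ), ∀ d : Euc m, ‖d‖ = 1 →
      fderivSnd P.h (u.1, u.2.1) d = 0 →
      (∀ i, P.g (x, y) i = 0 → fderivSnd P.g (u.1, u.2.1) d i ≤ 0) →
      fderivSnd P.f (u.1, u.2.1) d ≤ 0 → 0 < fderiv ℝ P.lagDeriv u (0, d, 0, 0) d := by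
    refine eventually_forall_unit (Q := fun (u : Euc n × Euc m × Euc r × Euc s) (d : Euc m) =>
      fderivSnd P.h (u.1, u.2.1) d = 0 →
      (∀ i, P.g (x, y) i = 0 → fderivSnd P.g (u.1, u.2.1) d i ≤ 0) →
      fderivSnd P.f (u.1, u.2.1) d ≤ 0 → 0 < fderiv ℝ P.lagDeriv u (0, d, 0, 0) d) ?_
    intro d hd
    have hd0 : d ≠ 0 := fun h => by simp [h] at hd
    rw [← nhds_prod_eq]
    have hc : ∀ {V : Type} [NormedAddCommGroup V] [NormedSpace ℝ V] {φ : Euc n × Euc m → V},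
        IsC2C3Snd φ (x, y) → ContinuousAt (fun v : (Euc n × Euc m × Euc r × Euc s) × Euc m =>
          fderivSnd φ (v.1.1, v.1.2.1) v.2) ((x, y, μ, ξ), d) := by
      intro V _ _ φ hφ
      have h1 := ContinuousAt.comp (f := Prod.fst) (x := ((x, y, μ, ξ), d))
        (continuousAt_fderivSnd (μ := μ) (ξ := ξ) hφ) continuousAt_fst
      exact h1.clm_apply continuousAt_snd
    by_cases h1 : fderivSnd P.h (x, y) d = 0
    swap
    · filter_upwards [(hc hP.h).eventually_ne h1] with v hv h
      exact absurd h hv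
    by_cases h2 : ∀ i, P.g (x, y) i = 0 → fderivSnd P.g (x, y) d i ≤ 0
    swap
    · push Not at h2
      obtain ⟨i, hi0, hi⟩ := h2
      have hci := (EuclideanSpace.proj i : Euc s →L[ℝ] ℝ).continuous.continuousAt.comp
        (hc hP.g)
      filter_upwards [hci.eventually (lt_mem_nhds hi)] with v hv _ h
      exact absurd (h i hi0) (not_le.2 hv)
    by_cases h3 : fderivSnd P.f (x, y) d ≤ 0
    swap
    · push Not at h3
      filter_upwards [(hc hP.f).eventually (lt_mem_nhds h3)] with v hv _ _ h
      exact absurd h (not_le.2 hv)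
    have hpos := hJ.sosc d ⟨h1, fun i hi => by
      rw [fderivSnd_coord hP.g.differentiableAt]; exact h2 i hi, h3⟩ hd0
    rw [hessQuad_lowerLagrangian hP] at hpos
    filter_upwards [(continuousAt_lagHess hP d).eventually (lt_mem_nhds hpos)] with v hv _ _ _
    exact hv
  filter_upwards [key, tendsto_pair.eventually hP.eventually] with u hu hPu hact d hd hd0
  rw [hessQuad_lowerLagrangian hPu]
  have hn : 0 < ‖d‖ := norm_pos_iff.2 hd0
  have h1 := hu (‖d‖⁻¹ • d) (by rw [norm_smul, norm_inv, norm_norm, inv_mul_cancel₀ hn.ne'])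
    (by rw [map_smul, show fderivSnd P.h (u.1, u.2.1) d = 0 from hd.1, smul_zero])
    (fun i hi => by
      have := hd.2.1 i (hact i hi)
      rw [fderivSnd_coord hPu.g.differentiableAt] at this
      rw [map_smul, PiLp.smul_apply]
      exact mul_nonpos_of_nonneg_of_nonpos (inv_nonneg.2 hn.le) this)
    (by
      rw [map_smul]
      exact mul_nonpos_of_nonneg_of_nonpos (inv_nonneg.2 hn.le) hd.2.2)
  have h2 : ((0 : Euc n), ‖d‖⁻¹ • d, (0 : Euc r), (0 : Euc s)) = ‖d‖⁻¹ • (0, d, 0, 0) := by simp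
  rw [h2, map_smul, map_smul, smul_apply, smul_eq_mul, smul_eq_mul] at h1
  exact pos_of_mul_pos_right (pos_of_mul_pos_right h1 (inv_nonneg.2 hn.le))
    (inv_nonneg.2 hn.le)

/-- Near a point where the Jacobian uniqueness conditions hold they hold at every zero of the
KKT map. -/
theorem JacobianUniqueness.eventually_of_kktMap_eq_zero (hJ : P.JacobianUniqueness x y μ ξ)
    (hP : P.LowerSmoothAt (x, y)) :
    ∀ᶠ u : Euc n × Euc m × Euc r × Euc s in 𝓝 (x, y, μ, ξ), P.kktMap u = 0 →
      P.JacobianUniqueness u.1 u.2.1 u.2.2.1 u.2.2.2 := by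
  have hξc : ContinuousAt (fun u : Euc n × Euc m × Euc r × Euc s => u.2.2.2) (x, y, μ, ξ) := by
    fun_prop
  have hproj : ∀ i, Continuous fun v : Euc s => v i := fun i => by fun_prop
  have hstrict : ∀ᶠ u : Euc n × Euc m × Euc r × Euc s in 𝓝 (x, y, μ, ξ),
      ∀ i, 0 < u.2.2.2 i - P.g (u.1, u.2.1) i := by
    refine eventually_all.2 fun i => ?_
    have hc := ((hproj i).continuousAt.comp hξc).sub
      ((hproj i).continuousAt.comp (continuousAt_comp_pair (μ := μ) (ξ := ξ) hP.g))
    exact hc.eventually (lt_mem_nhds (hJ.strict i))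
  have hactive : ∀ᶠ u : Euc n × Euc m × Euc r × Euc s in 𝓝 (x, y, μ, ξ),
      ∀ i, (P.g (x, y) i = 0 → 0 < u.2.2.2 i) ∧ (P.g (x, y) i ≠ 0 → P.g (u.1, u.2.1) i ≠ 0) := by
    refine eventually_all.2 fun i => ?_
    by_cases hi : P.g (x, y) i = 0
    · have hc := (hproj i).continuousAt.comp hξc
      filter_upwards [hc.eventually (lt_mem_nhds (hJ.multiplier_pos hi))] with u hu
      exact ⟨fun _ => hu, fun h => absurd hi h⟩
    · have hc := (hproj i).continuousAt.comp (continuousAt_comp_pair (μ := μ) (ξ := ξ) hP.g)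
      filter_upwards [hc.eventually_ne hi] with u hu
      exact ⟨fun h => absurd h hi, fun _ => hu⟩
  filter_upwards [hstrict, hactive, hJ.eventually_licq hP, hJ.eventually_sosc hP]
    with u h1 h2 h3 h4 hu
  have hu1 : P.gradYLagrangian u.1 u.2.1 u.2.2.1 u.2.2.2 = 0 := congrArg Prod.fst hu
  have hu2 : P.h (u.1, u.2.1) = 0 := congrArg (fun v => v.2.1) hu
  have hu3 := sub_projNonpos_eq_zero_iff.1 (congrArg (fun v => v.2.2) hu :
    P.g (u.1, u.2.1) - projNonpos (P.g (u.1, u.2.1) + u.2.2.2) = 0)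
  refine ⟨hu1, hu2, fun i => (hu3 i).1, fun i => (hu3 i).2.1,
    (inner_eq_zero_iff_of_nonneg_of_nonpos (fun i => (hu3 i).1) (fun i => (hu3 i).2.1)).2
      fun i => (hu3 i).2.2, ?_, h1, ?_⟩
  · have hsub : ∀ i, P.g (u.1, u.2.1) i = 0 → P.g (x, y) i = 0 := fun i hi => by
      by_contra h
      exact (h2 i).2 h hi
    have hinj : Function.Injective
        (Sum.map id (Subtype.map id hsub) : Fin r ⊕ {i // P.g (u.1, u.2.1) i = 0} →
          Fin r ⊕ {i // P.g (x, y) i = 0}) :=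
      Function.injective_id.sumMap (Subtype.map_injective hsub Function.injective_id)
    have := h3.comp _ hinj
    rwa [Sum.elim_comp_map] at this
  · exact h4 fun i hi => (mul_eq_zero.1 (hu3 i).2.2).resolve_left ((h2 i).1 hi).ne'

/-! ### Strict local minimality in the lower level problem -/

theorem lowerLagrangian_le {z : Euc m} (hz : z ∈ P.Y x) (hξ : ∀ i, 0 ≤ ξ i) :
    P.lowerLagrangian x z μ ξ ≤ P.f (x, z) := by
  have h5 : inner ℝ ξ (P.g (x, z)) ≤ 0 := by
    rw [PiLp.inner_apply]
    refine Finset.sum_nonpos fun i _ => ?_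
    simpa using mul_nonpos_of_nonpos_of_nonneg (hz.2 i) (hξ i)
  rw [lowerLagrangian, hz.1, inner_zero_right]
  linarith

/-- The Jacobian uniqueness conditions give strict local minimality in the lower level problem, on
a neighbourhood that is uniform in the parameter. -/
theorem JacobianUniqueness.eventually_lt (hJ : P.JacobianUniqueness x y μ ξ)
    (hP : P.LowerSmoothAt (x, y)) :
    ∀ᶠ a : (Euc n × Euc m × Euc r × Euc s) × Euc m in 𝓝 ((x, y, μ, ξ), y),
      P.JacobianUniqueness a.1.1 a.1.2.1 a.1.2.2.1 a.1.2.2.2 → a.2 ∈ P.Y a.1.1 → a.2 ≠ a.1.2.1 →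
        P.f (a.1.1, a.1.2.1) < P.f (a.1.1, a.2) := by
  suffices hmain : ∀ᶠ a : (Euc n × Euc m × Euc r × Euc s) × Euc m in 𝓝 ((x, y, μ, ξ), y),
      a.2 - a.1.2.1 ≠ 0 → (P.JacobianUniqueness a.1.1 a.1.2.1 a.1.2.2.1 a.1.2.2.2 →
        a.2 ∈ P.Y a.1.1 → P.f (a.1.1, a.1.2.1) < P.f (a.1.1, a.2)) by
    filter_upwards [hmain] with a ha h1 h2 h3
    exact ha (sub_ne_zero.2 h3) h1 h2
  refine eventually_of_forall_direction fun d hd => ?_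
  have hd0 : d ≠ 0 := fun h => by simp [h] at hd
  have hpair : Tendsto
      (fun b : ((Euc n × Euc m × Euc r × Euc s) × Euc m) × Euc m =>
        (((b.1.1.1, b.1.1.2.1), (b.1.1.1, b.1.2)), ((0 : Euc n), b.2)))
      (𝓝 ((x, y, μ, ξ), y) ×ˢ 𝓝 d) (𝓝 ((x, y), (x, y)) ×ˢ 𝓝 (0, d)) := by
    rw [← nhds_prod_eq, ← nhds_prod_eq]
    exact Continuous.tendsto (by fun_prop) (((x, y, μ, ξ), y), d)
  have hstep : ∀ {b : ((Euc n × Euc m × Euc r × Euc s) × Euc m) × Euc m},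
      b.1.2 - b.1.1.2.1 = ‖b.1.2 - b.1.1.2.1‖ • b.2 →
      (b.1.1.1, b.1.2) - (b.1.1.1, b.1.1.2.1) = ‖b.1.2 - b.1.1.2.1‖ • ((0 : Euc n), b.2) := by
    intro b hb
    rw [Prod.mk_sub_mk, sub_self, Prod.smul_mk, smul_zero, ← hb]
  -- near a noncritical `d` a first order estimate excludes feasible points or makes `f` increase; a
  -- positive multiplier keeps a constraint that is active at `(x, y)` active at nearby KKT points
  have hfs := hP.f.1.hasStrictFDerivAt (by simp)
  have hhs := hP.h.1.hasStrictFDerivAt (by simp)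
  have hgs := hP.g.1.hasStrictFDerivAt (by simp)
  by_cases h1 : fderivSnd P.h (x, y) d = 0
  swap
  · obtain ⟨l, hl⟩ := exists_clm_pos h1
    have hs : HasStrictFDerivAt (fun z => l (P.h z)) (l.comp (fderiv ℝ P.h (x, y))) (x, y) :=
      l.hasStrictFDerivAt.comp (x, y) hhs
    rw [fderivSnd_apply hP.h.differentiableAt] at hl
    filter_upwards [hpair.eventually (hs.eventually_mul_le_sub (d := (0, d)) (half_lt_self hl))]
      with b hb hb0 hbd hbJ hbY
    have := hb _ (norm_nonneg _) (hstep hbd)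
    simp only [hbJ.eq_feasible, hbY.1, map_zero, sub_self] at this
    have hpos := mul_pos (half_pos hl) (norm_pos_iff.2 hb0)
    simp only [ContinuousLinearMap.comp_apply] at this hpos
    linarith
  by_cases h2 : ∀ i, P.g (x, y) i = 0 → fderivSnd P.g (x, y) d i ≤ 0
  swap
  · push Not at h2
    obtain ⟨i, hi0, hi⟩ := h2
    have hs : HasStrictFDerivAt (fun z => P.g z i)
        ((EuclideanSpace.proj i : Euc s →L[ℝ] ℝ).comp (fderiv ℝ P.g (x, y)))
        (x, y) :=
      (EuclideanSpace.proj i : Euc s →L[ℝ] ℝ).hasStrictFDerivAt.comp (x, y) hgs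
    rw [fderivSnd_apply hP.g.differentiableAt] at hi
    replace hi : 0 < ((EuclideanSpace.proj i : Euc s →L[ℝ] ℝ).comp (fderiv ℝ P.g (x, y))) (0, d) :=
      hi
    have hξ : ∀ᶠ b : ((Euc n × Euc m × Euc r × Euc s) × Euc m) × Euc m in
        𝓝 ((x, y, μ, ξ), y) ×ˢ 𝓝 d, 0 < b.1.1.2.2.2 i := by
      rw [← nhds_prod_eq]
      have hc : ContinuousAt (fun b : ((Euc n × Euc m × Euc r × Euc s) × Euc m) × Euc m =>
        b.1.1.2.2.2 i) (((x, y, μ, ξ), y), d) := by fun_prop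
      exact hc.eventually (lt_mem_nhds (hJ.multiplier_pos hi0))
    filter_upwards [hpair.eventually (hs.eventually_mul_le_sub (d := (0, d)) (half_lt_self hi)), hξ]
      with b hb hbξ hb0 hbd hbJ hbY
    have := hb _ (norm_nonneg _) (hstep hbd)
    have hact : P.g (b.1.1.1, b.1.1.2.1) i = 0 :=
      (mul_eq_zero.1 (hbJ.complementary_apply i)).resolve_left hbξ.ne'
    simp only [hact] at this
    have hpos := mul_pos (half_pos hi) (norm_pos_iff.2 hb0)
    simp only [ContinuousLinearMap.comp_apply] at this hpos
    linarith [hbY.2 i]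
  by_cases h3 : fderivSnd P.f (x, y) d ≤ 0
  swap
  · push Not at h3
    rw [fderivSnd_apply hP.f.differentiableAt] at h3
    filter_upwards [hpair.eventually (hfs.eventually_mul_le_sub (half_lt_self h3))]
      with b hb hb0 hbd _ _
    have := hb _ (norm_nonneg _) (hstep hbd)
    have hpos := mul_pos (half_pos h3) (norm_pos_iff.2 hb0)
    linarith
  have hq := hJ.sosc d ⟨h1, fun i hi => by
    rw [fderivSnd_coord hP.g.differentiableAt]; exact h2 i hi, h3⟩ hd0
  rw [hessQuad_lowerLagrangian hP] at hq
  -- the expansion in `y` is taken with `(x, μ, ξ)` as the parameter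
  set σ : (Euc n × Euc r × Euc s) × Euc m → Euc n × Euc m × Euc r × Euc s :=
    fun w => (w.1.1, w.2, w.1.2.1, w.1.2.2) with hσ
  set σ' : (Euc n × Euc r × Euc s) × Euc m →L[ℝ] Euc n × Euc m × Euc r × Euc s :=
    ((ContinuousLinearMap.fst ℝ _ _).comp (ContinuousLinearMap.fst ℝ _ _)).prod
      ((ContinuousLinearMap.snd ℝ _ _).prod
        ((ContinuousLinearMap.snd ℝ _ _).comp (ContinuousLinearMap.fst ℝ _ _))) with hσ'
  have hψ : HasStrictFDerivAt (fun w => P.lagDeriv (σ w))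
      ((fderiv ℝ P.lagDeriv (x, y, μ, ξ)).comp σ') ((x, μ, ξ), y) :=
    HasStrictFDerivAt.comp (f := σ) ((x, μ, ξ), y)
      ((contDiffAt_lagDeriv (μ := μ) (ξ := ξ) hP).hasStrictFDerivAt (by simp))
      σ'.hasStrictFDerivAt
  have hφ : ∀ᶠ w : (Euc n × Euc r × Euc s) × Euc m in 𝓝 ((x, μ, ξ), y),
      HasFDerivAt (fun z => P.lowerLagrangian w.1.1 z w.1.2.1 w.1.2.2) (P.lagDeriv (σ w)) w.2 := by
    have hc : ContinuousAt (fun w : (Euc n × Euc r × Euc s) × Euc m => (w.1.1, w.2))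
      ((x, μ, ξ), y) := by fun_prop
    filter_upwards [hc.eventually hP.eventually] with w hw
    exact hasFDerivAt_lowerLagrangian hw _ _
  have htay := eventually_add_mul_sq_le (d := d)
    (φ := fun (a : Euc n × Euc r × Euc s) z => P.lowerLagrangian a.1 z a.2.1 a.2.2)
    (c := fderiv ℝ P.lagDeriv (x, y, μ, ξ) (0, d, 0, 0) d / 4) hφ hψ (by
      change _ < fderiv ℝ P.lagDeriv (x, y, μ, ξ) (0, d, 0, 0) d / 2
      linarith)
  have htr : Tendsto
      (fun b : ((Euc n × Euc m × Euc r × Euc s) × Euc m) × Euc m =>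
        (((b.1.1.1, b.1.1.2.2.1, b.1.1.2.2.2), b.1.1.2.1, b.1.2), b.2))
      (𝓝 ((x, y, μ, ξ), y) ×ˢ 𝓝 d) (𝓝 ((x, μ, ξ), y, y) ×ˢ 𝓝 d) := by
    rw [← nhds_prod_eq, ← nhds_prod_eq]
    exact Continuous.tendsto (by fun_prop) (((x, y, μ, ξ), y), d)
  have hPe : ∀ᶠ b : ((Euc n × Euc m × Euc r × Euc s) × Euc m) × Euc m in
      𝓝 ((x, y, μ, ξ), y) ×ˢ 𝓝 d, P.LowerSmoothAt (b.1.1.1, b.1.1.2.1) := by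
    rw [← nhds_prod_eq]
    have hc : ContinuousAt (fun b : ((Euc n × Euc m × Euc r × Euc s) × Euc m) × Euc m =>
      (b.1.1.1, b.1.1.2.1)) (((x, y, μ, ξ), y), d) := by fun_prop
    exact hc.eventually hP.eventually
  filter_upwards [htr.eventually htay, hPe] with b hb hPb hb0 hbd hbJ hbY
  have h4 := hb _ hbd
  have hstat : P.lagDeriv (b.1.1.1, b.1.1.2.1, b.1.1.2.2.1, b.1.1.2.2.2) = 0 :=
    lagDeriv_eq_zero hPb hbJ.stationary
  simp only [hσ, hstat, zero_apply, add_zero] at h4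
  have h5 := lowerLagrangian_le (μ := b.1.1.2.2.1) hbY hbJ.multiplier_nonneg
  have h6 : P.lowerLagrangian b.1.1.1 b.1.1.2.1 b.1.1.2.2.1 b.1.1.2.2.2 =
      P.f (b.1.1.1, b.1.1.2.1) := by
    rw [lowerLagrangian, hbJ.eq_feasible, hbJ.complementary, inner_zero_right, add_zero, add_zero]
  have hpos : 0 < fderiv ℝ P.lagDeriv (x, y, μ, ξ) (0, d, 0, 0) d / 4 *
      ‖b.1.2 - b.1.1.2.1‖ ^ 2 :=
    mul_pos (by linarith) (pow_pos (norm_pos_iff.2 hb0) 2)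
  linarith

end BilevelProgram

namespace BilevelProgram

variable {n m p q r s : ℕ} {P : BilevelProgram n m p q r s}
  {x : Euc n} {y : Euc m} {μ : Euc r} {ξ : Euc s}

/-! ### The solution branch -/

theorem JacobianUniqueness.exists_implicit (hJ : P.JacobianUniqueness x y μ ξ)
    (hP : P.LowerSmoothAt (x, y)) :
    ∃ ψ : Euc n → Euc m × Euc r × Euc s, ContDiffAt ℝ 2 ψ x ∧ ψ x = (y, μ, ξ) ∧
      ∀ᶠ u in 𝓝 (x, y, μ, ξ), P.kktMap u = 0 ↔ ψ u.1 = u.2 := by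
  have hK := contDiffAt_kktMap (μ := μ) hP hJ.add_ne_zero
  have hinv := hJ.isInvertible hP
  refine ⟨hK.implicitFunction (by simp) hinv, hK.contDiffAt_implicitFunction (by simp) hinv,
    hK.implicitFunction_apply_self (by simp) hinv, ?_⟩
  have h := hK.eventually_apply_eq_iff_implicitFunction (by simp) hinv
  rwa [hJ.kktMap_eq_zero] at h

theorem JacobianUniqueness.exists_isSolutionBranch (hJ : P.JacobianUniqueness x y μ ξ)
    (hP : P.LowerSmoothAt (x, y)) :
    ∃ (δ ε : ℝ) (y' : Euc n → Euc m) (μ' : Euc n → Euc r) (ξ' : Euc n → Euc s),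
      P.IsSolutionBranch 2 x y μ ξ δ ε y' μ' ξ' := by
  obtain ⟨ψ, hψ, hψx, hiff⟩ := hJ.exists_implicit hP
  have hu : Tendsto (fun x' => (x', ψ x')) (𝓝 x) (𝓝 (x, y, μ, ξ)) := by
    rw [← hψx]
    exact continuousAt_id.prodMk hψ.continuousAt
  have hmem : ∀ᶠ x' in 𝓝 x, ψ x' ∈ Metric.closedBall (y, μ, ξ) 1 :=
    hψ.continuousAt.eventually (by rw [hψx]; exact Metric.closedBall_mem_nhds _ one_pos)
  obtain ⟨δ, hδ, hball⟩ := Metric.nhds_basis_closedBall.eventually_iff.1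
    ((hψ.eventually (by simp)).and (hmem.and
      ((hu.eventually hiff).and (hu.eventually (hJ.eventually_of_kktMap_eq_zero hP)))))
  have hmem' : ∀ x' ∈ Metric.closedBall x δ, dist (ψ x').1 y ≤ 1 ∧
      dist (ψ x').2.1 μ ≤ 1 ∧ dist (ψ x').2.2 ξ ≤ 1 := by
    intro x' hx'
    have := (hball hx').2.1
    simpa [Prod.dist_eq] using this
  refine ⟨δ, 1, fun x' => (ψ x').1, fun x' => (ψ x').2.1, fun x' => (ψ x').2.2, hδ, one_pos,
    by simp [hψx], by simp [hψx], by simp [hψx],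
    fun x' hx' => (contDiffAt_fst.comp x' (hball hx').1).contDiffWithinAt,
    fun x' hx' => ((contDiffAt_fst.comp _ contDiffAt_snd).comp x' (hball hx').1).contDiffWithinAt,
    fun x' hx' => ((contDiffAt_snd.comp _ contDiffAt_snd).comp x' (hball hx').1).contDiffWithinAt,
    fun x' hx' => (hmem' x' hx').1, fun x' hx' => (hmem' x' hx').2.1,
    fun x' hx' => (hmem' x' hx').2.2, fun x' hx' => ?_⟩
  exact (hball hx').2.2.2 ((hball hx').2.2.1.2 rfl)

section Branch

variable {k : ℕ} {δ ε : ℝ} {Y : Euc n → Euc m} {M : Euc n → Euc r} {Ξ : Euc n → Euc s}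

theorem IsSolutionBranch.continuousAt (hb : P.IsSolutionBranch k x y μ ξ δ ε Y M Ξ) :
    ContinuousAt (fun x' => (x', Y x', M x', Ξ x')) x := by
  have hn := Metric.closedBall_mem_nhds x hb.radius_pos
  exact continuousAt_id.prodMk ((hb.y_contDiffOn.continuousOn.continuousAt hn).prodMk
    ((hb.μ_contDiffOn.continuousOn.continuousAt hn).prodMk
      (hb.ξ_contDiffOn.continuousOn.continuousAt hn)))

theorem IsSolutionBranch.tendsto (hb : P.IsSolutionBranch k x y μ ξ δ ε Y M Ξ) :
    Tendsto (fun x' => (x', Y x', M x', Ξ x')) (𝓝 x) (𝓝 (x, y, μ, ξ)) := by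
  have h := hb.continuousAt.tendsto
  rwa [hb.y_center, hb.μ_center, hb.ξ_center] at h

theorem IsSolutionBranch.eventually_kktMap_eq_zero
    (hb : P.IsSolutionBranch k x y μ ξ δ ε Y M Ξ) :
    ∀ᶠ x' in 𝓝 x, P.kktMap (x', Y x', M x', Ξ x') = 0 := by
  filter_upwards [Metric.closedBall_mem_nhds x hb.radius_pos] with x' hx'
  exact (hb.jacobianUniqueness x' hx').kktMap_eq_zero

/-- A continuous branch coincides near its centre with the implicit function of the KKT map. -/
theorem IsSolutionBranch.contDiffAt (hb : P.IsSolutionBranch k x y μ ξ δ ε Y M Ξ)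
    (hJ : P.JacobianUniqueness x y μ ξ) (hP : P.LowerSmoothAt (x, y)) :
    ContDiffAt ℝ 2 (fun x' => (Y x', M x', Ξ x')) x := by
  obtain ⟨ψ, hψ, -, hiff⟩ := hJ.exists_implicit hP
  refine hψ.congr_of_eventuallyEq ?_
  filter_upwards [hb.tendsto.eventually hiff, hb.eventually_kktMap_eq_zero] with x' h1 h2
  exact (h1.1 h2).symm

end Branch

/-! ### Equivalence of the two second order conditions -/

/-- The part of the Lagrangians which only involves the upper level data. -/
noncomputable def upperLagrangian (P : BilevelProgram n m p q r s) (l : Euc p × Euc q)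
    (u : Euc n × Euc m × Euc r × Euc s) : ℝ :=
  P.F (u.1, u.2.1) + inner ℝ l.1 (P.H (u.1, u.2.1)) + inner ℝ l.2 (P.G (u.1, u.2.1))

/-- The pairing of the multipliers `(λ_ℒ, λ_h, λ_g)` with the values of the KKT map. -/
noncomputable def kktPairing (l : Euc m × Euc r × Euc s) : Euc m × Euc r × Euc s →L[ℝ] ℝ :=
  (innerSL ℝ l.1).coprod ((innerSL ℝ l.2.1).coprod (innerSL ℝ l.2.2))

theorem kktPairing_apply (l z : Euc m × Euc r × Euc s) :
    kktPairing l z = inner ℝ l.1 z.1 + (inner ℝ l.2.1 z.2.1 + inner ℝ l.2.2 z.2.2) := rfl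

theorem exists_kktPairing_eq (ℓ : Euc m × Euc r × Euc s →L[ℝ] ℝ) :
    ∃ l : Euc m × Euc r × Euc s, kktPairing l = ℓ := by
  refine ⟨((InnerProductSpace.toDual ℝ _).symm (ℓ.comp (ContinuousLinearMap.inl ℝ _ _)),
    (InnerProductSpace.toDual ℝ _).symm ((ℓ.comp (ContinuousLinearMap.inr ℝ _ _)).comp
      (ContinuousLinearMap.inl ℝ _ _)),
    (InnerProductSpace.toDual ℝ _).symm ((ℓ.comp (ContinuousLinearMap.inr ℝ _ _)).comp
      (ContinuousLinearMap.inr ℝ _ _))), ContinuousLinearMap.ext fun z => ?_⟩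
  simp only [kktPairing_apply, InnerProductSpace.toDual_symm_apply,
    ContinuousLinearMap.comp_apply, ContinuousLinearMap.inl_apply, ContinuousLinearMap.inr_apply,
    ← map_add]
  simp

theorem lagrangianFP_eq (l : Euc p × Euc q × Euc m × Euc r × Euc s) :
    P.lagrangianFP l = fun u =>
      P.upperLagrangian (l.1, l.2.1) u + kktPairing l.2.2 (P.kktMap u) := by
  funext u
  rw [kktPairing_apply]
  simp only [lagrangianFP, upperLagrangian, kktMap]
  ring

/-- The upper level data are twice continuously differentiable at `z`. -/
structure UpperSmoothAt (P : BilevelProgram n m p q r s) (z : Euc n × Euc m) : Prop where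
  F : ContDiffAt ℝ 2 P.F z
  G : ContDiffAt ℝ 2 P.G z
  H : ContDiffAt ℝ 2 P.H z

theorem contDiffAt_upperLagrangian (hU : P.UpperSmoothAt (x, y)) (l : Euc p × Euc q) :
    ContDiffAt ℝ 2 (P.upperLagrangian l) (x, y, μ, ξ) := by
  have hz : ContDiffAt ℝ 2 (fun u : Euc n × Euc m × Euc r × Euc s => (u.1, u.2.1))
      (x, y, μ, ξ) := by fun_prop
  have hF := ContDiffAt.comp (x, y, μ, ξ) hU.F hz
  have hH := ContDiffAt.comp (x, y, μ, ξ) hU.H hz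
  have hG := ContDiffAt.comp (x, y, μ, ξ) hU.G hz
  exact (hF.add (contDiffAt_const.inner ℝ hH)).add (contDiffAt_const.inner ℝ hG)

/-- The hypotheses under which the implicit and the first order reformulations are compared: a
smooth curve `x' ↦ v x'` of zeros of the KKT map through `(y, μ, ξ)`. -/
structure IsKKTCurve (P : BilevelProgram n m p q r s) (x : Euc n) (y : Euc m) (μ : Euc r)
    (ξ : Euc s) (v : Euc n → Euc m × Euc r × Euc s) : Prop where
  contDiffAt : ContDiffAt ℝ 2 v x
  center : v x = (y, μ, ξ)
  eventually_zero : ∀ᶠ x' in 𝓝 x, P.kktMap (x', v x') = 0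

section Curve

variable {v : Euc n → Euc m × Euc r × Euc s}

theorem IsKKTCurve.hasFDerivAt (hv : P.IsKKTCurve x y μ ξ v) :
    HasFDerivAt (fun x' => (x', v x')) ((ContinuousLinearMap.id ℝ (Euc n)).prod (fderiv ℝ v x))
      x :=
  (hasFDerivAt_id x).prodMk (hv.contDiffAt.differentiableAt (by simp)).hasFDerivAt

theorem IsKKTCurve.fderiv_fst (hv : P.IsKKTCurve x y μ ξ v) (d : Euc n) :
    fderiv ℝ (fun x' => (v x').1) x d = (fderiv ℝ v x d).1 := by
  rw [fderiv.fst (hv.contDiffAt.differentiableAt (by simp))]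
  rfl

/-- The linearized KKT system determines the tangent of the curve. -/
theorem IsKKTCurve.fderiv_kktMap_eq_zero_iff (hv : P.IsKKTCurve x y μ ξ v)
    (hJ : P.JacobianUniqueness x y μ ξ) (hP : P.LowerSmoothAt (x, y))
    (d : Euc n × Euc m × Euc r × Euc s) :
    fderiv ℝ P.kktMap (x, y, μ, ξ) d = 0 ↔ d.2 = fderiv ℝ v x d.1 := by
  have hK := (contDiffAt_kktMap (μ := μ) hP hJ.add_ne_zero).differentiableAt (by simp)
  have h1 : HasFDerivAt (fun x' => P.kktMap (x', v x'))
      ((fderiv ℝ P.kktMap (x, y, μ, ξ)).comp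
        ((ContinuousLinearMap.id ℝ (Euc n)).prod (fderiv ℝ v x))) x := by
    refine HasFDerivAt.comp (g := P.kktMap) x ?_ hv.hasFDerivAt
    rw [hv.center]
    exact hK.hasFDerivAt
  have h2 : HasFDerivAt (fun x' => P.kktMap (x', v x'))
      (0 : Euc n →L[ℝ] Euc m × Euc r × Euc s) x :=
    (hasFDerivAt_const 0 x).congr_of_eventuallyEq hv.eventually_zero
  have h3 : fderiv ℝ P.kktMap (x, y, μ, ξ) (d.1, fderiv ℝ v x d.1) = 0 :=
    DFunLike.congr_fun (h1.unique h2) d.1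
  have h4 : d = (d.1, fderiv ℝ v x d.1) + (0, d.2 - fderiv ℝ v x d.1) := by ext1 <;> simp
  constructor
  · intro h
    rw [h4, map_add, h3, zero_add] at h
    have hinj : Function.Injective (fderiv ℝ P.kktMap (x, y, μ, ξ) ∘L
        ContinuousLinearMap.inr ℝ (Euc n) (Euc m × Euc r × Euc s)) := by
      obtain ⟨e, he⟩ := hJ.isInvertible hP
      rw [← he]
      exact e.injective
    have h5 := (injective_iff_map_eq_zero _).1 hinj (d.2 - fderiv ℝ v x d.1) h
    exact sub_eq_zero.1 h5
  · intro h
    have h5 : d = (d.1, fderiv ℝ v x d.1) := Prod.ext rfl h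
    rw [h5, h3]

theorem IsKKTCurve.lagrangianSP_eventuallyEq (hv : P.IsKKTCurve x y μ ξ v)
    (l : Euc p × Euc q × Euc m × Euc r × Euc s) :
    P.lagrangianSP (fun x' => (v x').1) (l.1, l.2.1) =ᶠ[𝓝 x]
      fun x' => P.lagrangianFP l (x', v x') := by
  filter_upwards [hv.eventually_zero] with x' hx'
  rw [lagrangianFP_eq]
  simp only [hx', map_zero, add_zero]
  rfl

theorem contDiffAt_lagrangianFP (hJ : P.JacobianUniqueness x y μ ξ)
    (hP : P.LowerSmoothAt (x, y)) (hU : P.UpperSmoothAt (x, y))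
    (l : Euc p × Euc q × Euc m × Euc r × Euc s) :
    ContDiffAt ℝ 2 (P.lagrangianFP l) (x, y, μ, ξ) := by
  rw [lagrangianFP_eq]
  exact (contDiffAt_upperLagrangian hU _).add
    ((kktPairing l.2.2).contDiff.contDiffAt.comp _ (contDiffAt_kktMap hP hJ.add_ne_zero))

theorem IsKKTCurve.fderiv_lagrangianSP (hv : P.IsKKTCurve x y μ ξ v)
    (hJ : P.JacobianUniqueness x y μ ξ) (hP : P.LowerSmoothAt (x, y))
    (hU : P.UpperSmoothAt (x, y)) (l : Euc p × Euc q × Euc m × Euc r × Euc s) (d : Euc n) :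
    fderiv ℝ (P.lagrangianSP (fun x' => (v x').1) (l.1, l.2.1)) x d =
      fderiv ℝ (P.lagrangianFP l) (x, y, μ, ξ) (d, fderiv ℝ v x d) := by
  rw [(hv.lagrangianSP_eventuallyEq l).fderiv_eq]
  have h1 : HasFDerivAt (fun x' => P.lagrangianFP l (x', v x'))
      ((fderiv ℝ (P.lagrangianFP l) (x, y, μ, ξ)).comp
        ((ContinuousLinearMap.id ℝ (Euc n)).prod (fderiv ℝ v x))) x := by
    refine HasFDerivAt.comp (g := P.lagrangianFP l) x ?_ hv.hasFDerivAt
    rw [hv.center]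
    exact ((contDiffAt_lagrangianFP hJ hP hU l).differentiableAt (by simp)).hasFDerivAt
  rw [h1.fderiv]
  rfl

set_option synthInstance.maxHeartbeats 200000 in
theorem IsKKTCurve.hessQuad_lagrangianSP (hv : P.IsKKTCurve x y μ ξ v)
    (hJ : P.JacobianUniqueness x y μ ξ) (hP : P.LowerSmoothAt (x, y))
    (hU : P.UpperSmoothAt (x, y)) {l : Euc p × Euc q × Euc m × Euc r × Euc s}
    (hl : fderiv ℝ (P.lagrangianFP l) (x, y, μ, ξ) = 0) (d : Euc n) :
    hessQuad (P.lagrangianSP (fun x' => (v x').1) (l.1, l.2.1)) x d =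
      hessQuad (P.lagrangianFP l) (x, y, μ, ξ) (d, fderiv ℝ v x d) := by
  rw [hessQuad_congr (hv.lagrangianSP_eventuallyEq l)]
  have hL := contDiffAt_lagrangianFP hJ hP hU l
  rw [← hv.center] at hL hl ⊢
  rw [hessQuad_comp_of_fderiv_eq_zero (u := fun x' => (x', v x')) hL
    (contDiffAt_id.prodMk hv.contDiffAt) hl, hv.hasFDerivAt.fderiv]
  rfl

theorem IsKKTCurve.multipliersSP_of_multipliersFP (hv : P.IsKKTCurve x y μ ξ v)
    (hJ : P.JacobianUniqueness x y μ ξ) (hP : P.LowerSmoothAt (x, y))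
    (hU : P.UpperSmoothAt (x, y)) {l : Euc p × Euc q × Euc m × Euc r × Euc s}
    (hl : l ∈ P.multipliersFP x y μ ξ) :
    (l.1, l.2.1) ∈ P.multipliersSP (fun x' => (v x').1) x := by
  obtain ⟨h1, h2, h3, h4, h5, -⟩ := hl
  refine ⟨ContinuousLinearMap.ext fun d => ?_, ?_⟩
  · rw [hv.fderiv_lagrangianSP hJ hP hU, h1]
    rfl
  · simp only [hv.center]
    exact ⟨h2, h3, h4, h5⟩

set_option synthInstance.maxHeartbeats 200000 in
/-- A multiplier of the implicit problem extends to one of the first order reformulation, the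
additional multipliers being the solution of the adjoint equation of the KKT system. -/
theorem IsKKTCurve.exists_multipliersFP (hv : P.IsKKTCurve x y μ ξ v)
    (hJ : P.JacobianUniqueness x y μ ξ) (hP : P.LowerSmoothAt (x, y))
    (hU : P.UpperSmoothAt (x, y)) {l : Euc p × Euc q}
    (hl : l ∈ P.multipliersSP (fun x' => (v x').1) x) :
    ∃ l' : Euc m × Euc r × Euc s, (l.1, l.2, l') ∈ P.multipliersFP x y μ ξ := by
  obtain ⟨h1, h2⟩ := hl
  simp only [hv.center] at h2
  obtain ⟨h2, h3, h4, h5⟩ := h2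
  obtain ⟨e, he⟩ := hJ.isInvertible hP
  set T : Euc m × Euc r × Euc s →L[ℝ] ℝ := fderiv ℝ (P.upperLagrangian l) (x, y, μ, ξ) ∘L
    ContinuousLinearMap.inr ℝ (Euc n) (Euc m × Euc r × Euc s) with hT
  obtain ⟨l', hl'⟩ := exists_kktPairing_eq (-(T.comp
    (e.symm : Euc m × Euc r × Euc s →L[ℝ] Euc m × Euc r × Euc s)))
  have hK := (contDiffAt_kktMap (μ := μ) hP hJ.add_ne_zero).differentiableAt (by simp)
  have hL : HasFDerivAt (P.lagrangianFP (l.1, l.2, l'))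
      (fderiv ℝ (P.upperLagrangian l) (x, y, μ, ξ) +
        (kktPairing l').comp (fderiv ℝ P.kktMap (x, y, μ, ξ))) (x, y, μ, ξ) := by
    rw [lagrangianFP_eq]
    exact ((contDiffAt_upperLagrangian hU _).differentiableAt (by simp)).hasFDerivAt.add
      ((kktPairing l').hasFDerivAt.comp _ hK.hasFDerivAt)
  have hvert : ∀ w, fderiv ℝ (P.lagrangianFP (l.1, l.2, l')) (x, y, μ, ξ) (0, w) = 0 := by
    intro w
    have hew : fderiv ℝ P.kktMap (x, y, μ, ξ) (0, w) = e w := (DFunLike.congr_fun he w).symm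
    rw [hL.fderiv, add_apply, ContinuousLinearMap.comp_apply, hew, hl', neg_apply,
      ContinuousLinearMap.comp_apply, ContinuousLinearEquiv.coe_coe, e.symm_apply_apply]
    exact add_neg_cancel _
  refine ⟨l', ContinuousLinearMap.ext fun d => ?_, h2, h3, h4, h5, hJ.stationary, hJ.eq_feasible,
    congrArg (fun z => z.2.2) hJ.kktMap_eq_zero⟩
  have hsplit : d = (d.1, fderiv ℝ v x d.1) + (0, d.2 - fderiv ℝ v x d.1) := by ext1 <;> simp
  have h6 := hv.fderiv_lagrangianSP hJ hP hU (l.1, l.2, l') d.1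
  simp only [Prod.mk.eta, h1] at h6
  rw [hsplit, map_add, hvert, ← h6]
  simp

/-- The critical directions of the first order reformulation are the tangents of the curve over the
critical directions of the implicit problem. -/
theorem IsKKTCurve.mem_criticalConeFP_iff (hv : P.IsKKTCurve x y μ ξ v)
    (hJ : P.JacobianUniqueness x y μ ξ) (hP : P.LowerSmoothAt (x, y))
    (d : Euc n × Euc m × Euc r × Euc s) :
    d ∈ P.criticalConeFP x y μ ξ ↔
      d.1 ∈ P.criticalConeSP (fun x' => (v x').1) x ∧ d.2 = fderiv ℝ v x d.1 := by
  have hlin : ∀ (dx : Euc n) (dy : Euc m) (dμ : Euc r) (dξ : Euc s),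
      (fderiv ℝ (fun x' => P.gradYLagrangian x' y μ ξ) x dx +
        fderiv ℝ (fun y' => P.gradYLagrangian x y' μ ξ) y dy +
        (fderiv ℝ (fun y' => P.h (x, y')) y).adjoint dμ +
        (fderiv ℝ (fun y' => P.g (x, y')) y).adjoint dξ = 0 ∧
      fderiv ℝ (fun x' => P.h (x', y)) x dx + fderiv ℝ (fun y' => P.h (x, y')) y dy = 0 ∧
      (ContinuousLinearMap.id ℝ (Euc s) - fderiv ℝ projNonpos (P.g (x, y) + ξ))
          (fderiv ℝ (fun x' => P.g (x', y)) x dx) +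
        (ContinuousLinearMap.id ℝ (Euc s) - fderiv ℝ projNonpos (P.g (x, y) + ξ))
          (fderiv ℝ (fun y' => P.g (x, y')) y dy) -
        fderiv ℝ projNonpos (P.g (x, y) + ξ) dξ = 0) ↔
      fderiv ℝ P.kktMap (x, y, μ, ξ) (dx, dy, dμ, dξ) = 0 := by
    intro dx dy dμ dξ
    have hG := hasFDerivAt_gradYLagrangian (μ := μ) (ξ := ξ) hP
    have e1 : HasFDerivAt (fun x' => P.gradYLagrangian x' y μ ξ) _ x :=
      HasFDerivAt.comp (f := fun x' => (x', y, μ, ξ)) x hG (hasFDerivAt_prodMk_left x (y, μ, ξ))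
    have e2 : HasFDerivAt (fun y' => P.gradYLagrangian x y' μ ξ) _ y :=
      HasFDerivAt.comp (f := fun y' => (x, y', μ, ξ)) y hG
        ((hasFDerivAt_prodMk_right x (y, μ, ξ)).comp y (hasFDerivAt_prodMk_left y (μ, ξ)))
    have e3 : (fderiv ℝ (fun y' => P.h (x, y')) y).adjoint dμ +
        (fderiv ℝ (fun y' => P.g (x, y')) y).adjoint dξ =
        gradOfDual m (fderiv ℝ P.lagDeriv (x, y, μ, ξ) (0, 0, dμ, dξ)) := by
      rw [fderiv_lagDeriv_multipliers hP, map_add, gradOfDual_innerSL_comp,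
        gradOfDual_innerSL_comp]
      rfl
    have e4 : fderiv ℝ P.lagDeriv (x, y, μ, ξ) (dx, dy, dμ, dξ) =
        fderiv ℝ P.lagDeriv (x, y, μ, ξ) (dx, 0, 0, 0) +
        fderiv ℝ P.lagDeriv (x, y, μ, ξ) (0, dy, 0, 0) +
        fderiv ℝ P.lagDeriv (x, y, μ, ξ) (0, 0, dμ, dξ) := by
      rw [← map_add, ← map_add]
      simp
    rw [fderiv_kktMap_apply hP hJ.add_ne_zero, Prod.mk_eq_zero, Prod.mk_eq_zero, add_assoc _ _
      ((fderiv ℝ (fun y' => P.g (x, y')) y).adjoint dξ), e3, e1.fderiv, e2.fderiv, e4, map_add,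
      map_add, fderiv_fst_add_fderiv_snd hP.h.differentiableAt, ← map_add,
      fderiv_fst_add_fderiv_snd hP.g.differentiableAt,
      (hasFDerivAt_projNonpos hJ.add_ne_zero).fderiv]
    refine and_congr Iff.rfl (and_congr Iff.rfl ?_)
    rw [sub_apply, ContinuousLinearMap.id_apply, map_add, sub_sub]
  have hcone : ∀ dx : Euc n, dx ∈ P.criticalConeSP (fun x' => (v x').1) x ↔
      (∀ i, P.G (x, y) i = 0 → fderiv ℝ (fun x' => P.G (x', y) i) x dx +
        fderiv ℝ (fun y' => P.G (x, y') i) y (fderiv ℝ v x dx).1 ≤ 0) ∧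
      fderiv ℝ (fun x' => P.F (x', y)) x dx +
        fderiv ℝ (fun y' => P.F (x, y')) y (fderiv ℝ v x dx).1 ≤ 0 ∧
      fderiv ℝ (fun x' => P.H (x', y)) x dx +
        fderiv ℝ (fun y' => P.H (x, y')) y (fderiv ℝ v x dx).1 = 0 := by
    intro dx
    simp only [criticalConeSP, mem_ofPred_eq, hv.fderiv_fst, hv.center]
    tauto
  constructor
  · rintro ⟨dx, dy, dμ, dξ, rfl, h1, h2, h3, h4⟩
    have h5 := (hv.fderiv_kktMap_eq_zero_iff hJ hP _).1 ((hlin dx dy dμ dξ).1 h4)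
    refine ⟨(hcone dx).2 ?_, h5⟩
    simp only at h5
    rw [← h5]
    exact ⟨h1, h2, h3⟩
  · rintro ⟨h1, h2⟩
    obtain ⟨dx, dy, dμ, dξ⟩ := d
    simp only at h1 h2
    have h3 := (hcone dx).1 h1
    rw [← h2] at h3
    exact ⟨dx, dy, dμ, dξ, rfl, h3.1, h3.2.1, h3.2.2, (hlin dx dy dμ dξ).2
      ((hv.fderiv_kktMap_eq_zero_iff hJ hP (dx, dy, dμ, dξ)).2 h2)⟩

theorem IsKKTCurve.SOSCSP_iff_SOSCFP (hv : P.IsKKTCurve x y μ ξ v)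
    (hJ : P.JacobianUniqueness x y μ ξ) (hP : P.LowerSmoothAt (x, y))
    (hU : P.UpperSmoothAt (x, y)) :
    P.SOSCSP (fun x' => (v x').1) x ↔ P.SOSCFP x y μ ξ := by
  unfold SOSCSP SOSCFP
  simp only [lt_iSup_iff]
  constructor
  · rintro ⟨⟨l, hl⟩, h⟩
    obtain ⟨l', hl'⟩ := hv.exists_multipliersFP hJ hP hU hl
    refine ⟨⟨_, hl'⟩, fun d hd hd0 => ?_⟩
    obtain ⟨hd1, hd2⟩ := (hv.mem_criticalConeFP_iff hJ hP d).1 hd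
    have hne : d.1 ≠ 0 := fun h0 => hd0 (Prod.ext h0 (by rw [hd2, h0, map_zero]; rfl))
    obtain ⟨l, hl, hpos⟩ := h d.1 hd1 hne
    obtain ⟨l', hl'⟩ := hv.exists_multipliersFP hJ hP hU hl
    refine ⟨_, hl', ?_⟩
    have := hv.hessQuad_lagrangianSP hJ hP hU hl'.1 d.1
    rw [← hd2] at this
    rwa [← this]
  · rintro ⟨⟨l, hl⟩, h⟩
    refine ⟨⟨_, hv.multipliersSP_of_multipliersFP hJ hP hU hl⟩, fun d hd hd0 => ?_⟩
    obtain ⟨l, hl, hpos⟩ := h (d, fderiv ℝ v x d)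
      ((hv.mem_criticalConeFP_iff hJ hP _).2 ⟨hd, rfl⟩) (fun h0 => hd0 (congrArg Prod.fst h0))
    refine ⟨_, hv.multipliersSP_of_multipliersFP hJ hP hU hl, ?_⟩
    rwa [hv.hessQuad_lagrangianSP hJ hP hU hl.1 d]

end Curve

end BilevelProgram

namespace BilevelProgram

variable {n m p q r s : ℕ} {P : BilevelProgram n m p q r s}
  {x : Euc n} {y : Euc m} {μ : Euc r} {ξ : Euc s} {Y : Euc n → Euc m}

/-! ### Quadratic growth and bi-local optimality -/

theorem fderiv_comp_graph {V : Type*} [NormedAddCommGroup V] [NormedSpace ℝ V]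
    {φ : Euc n × Euc m → V} (hφ : DifferentiableAt ℝ φ (x, Y x)) (hY : DifferentiableAt ℝ Y x)
    (d : Euc n) :
    fderiv ℝ (fun x' => φ (x', Y x')) x d =
      fderiv ℝ (fun x' => φ (x', Y x)) x d +
        fderiv ℝ (fun z => φ (x, z)) (Y x) (fderiv ℝ Y x d) := by
  have h : HasFDerivAt (fun x' => φ (x', Y x')) _ x :=
    HasFDerivAt.comp (g := φ) (f := fun x' => (x', Y x')) x hφ.hasFDerivAt
      ((hasFDerivAt_id x).prodMk hY.hasFDerivAt)
  rw [h.fderiv, fderiv_fst_add_fderiv_snd hφ]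
  rfl

theorem SOSCSP.exists_quadratic_growth (h : P.SOSCSP Y x) (hU : P.UpperSmoothAt (x, Y x))
    (hY : ContDiffAt ℝ 2 Y x) (hH0 : P.H (x, Y x) = 0) :
    ∃ γ : ℝ, 0 < γ ∧ ∀ᶠ x' in 𝓝 x, (x', Y x') ∈ P.Phi →
      P.F (x, Y x) + γ * ‖x' - x‖ ^ 2 ≤ P.F (x', Y x') := by
  have hg : ContDiffAt ℝ 2 (fun x' => (x', Y x')) x := contDiffAt_id.prodMk hY
  have hYd : DifferentiableAt ℝ Y x := hY.differentiableAt (by simp)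
  obtain ⟨γ, hγ, hev⟩ := _root_.exists_quadratic_growth (φ := fun x' => P.F (x', Y x'))
    (H := fun x' => P.H (x', Y x')) (G := fun x' => P.G (x', Y x')) (x₀ := x)
    (ContDiffAt.comp x hU.F hg) (ContDiffAt.comp x hU.H hg) (ContDiffAt.comp x hU.G hg) hH0 (by
      intro d hd h1 h2 h3
      have hGi : ∀ i, DifferentiableAt ℝ (fun z => P.G z i) (x, Y x) := fun i =>
        ((contDiffAt_piLp (p := 2)).1 hU.G i).differentiableAt (by simp)
      have hcone : d ∈ P.criticalConeSP Y x := by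
        refine ⟨?_, fun i hi => ?_, ?_⟩
        · rw [← h1, fderiv_comp_graph (hU.H.differentiableAt (by simp)) hYd]
        · rw [← fderiv_comp_graph (hGi i) hYd]
          exact h2 i hi
        · rw [← fderiv_comp_graph (hU.F.differentiableAt (by simp)) hYd]
          exact h3
      have h4 := h.2 d hcone hd
      simp only [lt_iSup_iff] at h4
      obtain ⟨l, hl, hpos⟩ := h4
      exact ⟨l, hl.1, hl.2.2.1, hl.2.2.2.2, EReal.coe_pos.1 hpos⟩)
  exact ⟨γ, hγ, hev.mono fun x' hx' hPhi => hx' hPhi.1 hPhi.2⟩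

/-- Along a solution branch, `Y x'` is the only candidate for a lower level minimizer near `y`. -/
theorem IsSolutionBranch.exists_forall_lt {k : ℕ} {δ ε : ℝ} {M : Euc n → Euc r}
    {Ξ : Euc n → Euc s} (hb : P.IsSolutionBranch k x y μ ξ δ ε Y M Ξ)
    (hJ : P.JacobianUniqueness x y μ ξ) (hP : P.LowerSmoothAt (x, y)) :
    ∃ ρ : ℝ, 0 < ρ ∧ ∀ᶠ x' in 𝓝 x, Y x' ∈ P.Y x' ∧
      ∀ z ∈ P.Y x' ∩ Metric.closedBall y ρ, z ≠ Y x' → P.f (x', Y x') < P.f (x', z) := by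
  have h1 : Tendsto (fun a : Euc n × Euc m => ((a.1, Y a.1, M a.1, Ξ a.1), a.2)) (𝓝 (x, y))
      (𝓝 ((x, y, μ, ξ), y)) := by
    rw [nhds_prod_eq, nhds_prod_eq]
    exact (hb.tendsto.comp tendsto_fst).prodMk tendsto_snd
  have h2 := h1.eventually (hJ.eventually_lt hP)
  rw [nhds_prod_eq, eventually_prod_iff] at h2
  obtain ⟨pa, hpa, pb, hpb, hab⟩ := h2
  obtain ⟨ρ, hρ, hball⟩ := Metric.nhds_basis_closedBall.eventually_iff.1 hpb
  refine ⟨ρ, hρ, ?_⟩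
  filter_upwards [hpa, Metric.closedBall_mem_nhds x hb.radius_pos] with x' hx' hx'δ
  have hJ' := hb.jacobianUniqueness x' hx'δ
  exact ⟨⟨hJ'.eq_feasible, hJ'.ineq_feasible⟩,
    fun z hz hne => hab hx' (hball hz.2) hJ' hz.1 hne⟩

theorem localArgmin_eq_singleton {c : Euc m} {η ρ : ℝ} (hηρ : η ≤ ρ)
    (hYx : Y x ∈ P.Y x) (hmem : Y x ∈ Metric.closedBall c η)
    (hlt : ∀ z ∈ P.Y x ∩ Metric.closedBall c ρ, z ≠ Y x → P.f (x, Y x) < P.f (x, z)) :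
    P.localArgmin x c η = {Y x} := by
  have hlt' : ∀ z ∈ P.Y x ∩ Metric.closedBall c η, z ≠ Y x → P.f (x, Y x) < P.f (x, z) :=
    fun z hz => hlt z ⟨hz.1, Metric.closedBall_subset_closedBall hηρ hz.2⟩
  refine Set.eq_singleton_iff_unique_mem.2 ⟨⟨⟨hYx, hmem⟩, fun z hz => ?_⟩, fun z hz => ?_⟩
  · by_cases h : z = Y x
    · rw [h]
    · exact (hlt' z hz h).le
  · by_contra h
    exact absurd (hz.2 (Y x) ⟨hYx, hmem⟩) (not_le.2 (hlt' z hz.1 h))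

/-- Strict lower level minimality along a differentiable branch and minimality of `F` along the
branch give a bi-local solution; a multiple of `δ` serves as `η(δ)`, with a factor for which the
branch stays in the balls `B_{η(δ)}(y)`. -/
theorem isBiLocalSolution_of_branch {ρ : ℝ} (hρ : 0 < ρ) (hPhi : (x, Y x) ∈ P.Phi)
    (hY : DifferentiableAt ℝ Y x)
    (hlt : ∀ᶠ x' in 𝓝 x, Y x' ∈ P.Y x' ∧
      ∀ z ∈ P.Y x' ∩ Metric.closedBall (Y x) ρ, z ≠ Y x' → P.f (x', Y x') < P.f (x', z))
    (hF : ∀ᶠ x' in 𝓝 x, (x', Y x') ∈ P.Phi → P.F (x, Y x) ≤ P.F (x', Y x')) :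
    P.IsBiLocalSolution x (Y x) := by
  obtain ⟨C, hC, hlip⟩ := hY.isBigO_sub.exists_pos
  obtain ⟨δ, hδ, hball⟩ := Metric.nhds_basis_closedBall.eventually_iff.1
    (hlt.and (hF.and hlip.bound))
  have hx : x ∈ Metric.closedBall x δ := Metric.mem_closedBall_self hδ.le
  have hargmin : ∀ t ∈ Ioc 0 (min δ (ρ / C)), ∀ x' ∈ Metric.closedBall x t,
      P.localArgmin x' (Y x) (C * t) = {Y x'} := by
    intro t ht x' hx'
    obtain ⟨⟨h1, h2⟩, -, h3⟩ := hball
      (Metric.closedBall_subset_closedBall (ht.2.trans (min_le_left _ _)) hx')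
    refine localArgmin_eq_singleton ?_ h1 ?_ h2
    · calc C * t ≤ C * (ρ / C) :=
            mul_le_mul_of_nonneg_left (ht.2.trans (min_le_right _ _)) hC.le
        _ = ρ := mul_div_cancel₀ _ hC.ne'
    · rw [Metric.mem_closedBall, dist_eq_norm] at hx' ⊢
      exact h3.trans (mul_le_mul_of_nonneg_left hx' hC.le)
  refine ⟨hPhi, (hball hx).1.1, min δ (ρ / C), lt_min hδ (div_pos hρ hC), fun t => C * t,
    fun t ht => mul_pos hC ht.1, ?_, fun t ht => ⟨fun z hz => ?_, ?_⟩⟩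
  · have : Tendsto (fun t : ℝ => C * t) (𝓝 0) (𝓝 (C * 0)) := Continuous.tendsto (by fun_prop) 0
    rw [mul_zero] at this
    exact this.mono_left nhdsWithin_le_nhds
  · have hmem : Y x ∈ P.localArgmin x (Y x) (C * t) := by
      rw [hargmin t ht x (Metric.mem_closedBall_self ht.1.le)]
      rfl
    exact hmem.2 z hz
  · intro x' y' hPhi' hx' _ hy'
    rw [hargmin t ht x' hx', mem_singleton_iff] at hy'
    subst hy'
    exact (hball (Metric.closedBall_subset_closedBall
      (ht.2.trans (min_le_left _ _)) hx')).2.1 hPhi'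

end BilevelProgram

theorem mainTheorem2 {n m p q r s : ℕ} (P : BilevelProgram n m p q r s)
    (xs : Euc n) (ys : Euc m) (μs : Euc r) (ξs : Euc s)
    (hf : IsC2C3Snd P.f (xs, ys)) (hg : IsC2C3Snd P.g (xs, ys)) (hh : IsC2C3Snd P.h (xs, ys))
    (hF : ContDiffAt ℝ 2 P.F (xs, ys)) (hG : ContDiffAt ℝ 2 P.G (xs, ys))
    (hH : ContDiffAt ℝ 2 P.H (xs, ys))
    (hPhi : (xs, ys) ∈ P.Phi) (hY : ys ∈ P.Y xs)
    (hJ : P.JacobianUniqueness xs ys μs ξs) :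
    (∃ (δ₁ ε₁ : ℝ) (y : Euc n → Euc m) (μ : Euc n → Euc r) (ξ : Euc n → Euc s),
      P.IsSolutionBranch 2 xs ys μs ξs δ₁ ε₁ y μ ξ) ∧
    ∀ (δ₁ ε₁ : ℝ) (y : Euc n → Euc m) (μ : Euc n → Euc r) (ξ : Euc n → Euc s),
      P.IsSolutionBranch 1 xs ys μs ξs δ₁ ε₁ y μ ξ →
      ContDiffAt ℝ 2 y xs ∧
      (P.SOSCSP y xs ↔ P.SOSCFP xs ys μs ξs) ∧
      (P.SOSCSP y xs ∨ P.SOSCFP xs ys μs ξs →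
        (∃ δ₂ ∈ Ioo 0 δ₁, ∃ ε₂ ∈ Ioo 0 ε₁, ∃ γ : ℝ, 0 < γ ∧
          ∀ x ∈ Metric.closedBall xs δ₂,
            P.localArgmin x ys ε₂ = {y x} ∧
            ((x, y x) ∈ P.Phi →
              P.F (xs, ys) + γ * ‖x - xs‖ ^ 2 ≤ P.F (x, y x))) ∧
        P.IsBiLocalSolution xs ys) := by
  have hP : P.LowerSmoothAt (xs, ys) := ⟨hf, hg, hh⟩
  have hU : P.UpperSmoothAt (xs, ys) := ⟨hF, hG, hH⟩
  refine ⟨hJ.exists_isSolutionBranch hP, fun δ₁ ε₁ y μ ξ hb => ?_⟩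
  have hv : P.IsKKTCurve xs ys μs ξs (fun x => (y x, μ x, ξ x)) :=
    ⟨hb.contDiffAt hJ hP, by simp only [hb.y_center, hb.μ_center, hb.ξ_center],
      hb.eventually_kktMap_eq_zero⟩
  have hy : ContDiffAt ℝ 2 y xs := contDiffAt_fst.comp xs hv.contDiffAt
  have hiff : P.SOSCSP y xs ↔ P.SOSCFP xs ys μs ξs := hv.SOSCSP_iff_SOSCFP hJ hP hU
  refine ⟨hy, hiff, fun h => ?_⟩
  have hSP : P.SOSCSP y xs := h.elim id hiff.2
  have hyc := hb.y_center
  obtain ⟨γ, hγ, hgrowth⟩ := hSP.exists_quadratic_growth (hyc ▸ hU) hy (hyc ▸ hPhi.1)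
  obtain ⟨ρ, hρ, hlt⟩ := hb.exists_forall_lt hJ hP
  constructor
  · set ε₂ := min (ε₁ / 2) ρ with hε₂
    have hε₁ := hb.target_radius_pos
    have hδ₁ := hb.radius_pos
    have hε₂pos : 0 < ε₂ := lt_min (half_pos hε₁) hρ
    have hmem : ∀ᶠ x in 𝓝 xs, y x ∈ Metric.closedBall ys ε₂ :=
      hy.continuousAt.eventually (by rw [hyc]; exact Metric.closedBall_mem_nhds _ hε₂pos)
    obtain ⟨δ, hδ, hball⟩ := Metric.nhds_basis_closedBall.eventually_iff.1
      (hgrowth.and (hlt.and hmem))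
    refine ⟨min δ (δ₁ / 2), ⟨lt_min hδ (half_pos hδ₁),
      (min_le_right _ _).trans_lt (half_lt_self hδ₁)⟩, ε₂,
      ⟨hε₂pos, (min_le_left _ _).trans_lt (half_lt_self hε₁)⟩, γ, hγ, fun x hx => ?_⟩
    obtain ⟨h1, ⟨h2, h3⟩, h4⟩ :=
      hball (Metric.closedBall_subset_closedBall (min_le_left _ _) hx)
    refine ⟨BilevelProgram.localArgmin_eq_singleton (min_le_right _ _) h2 h4 h3, fun hx => ?_⟩
    have := h1 hx
    rwa [hyc] at this
  · rw [← hyc] at hPhi hlt ⊢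
    refine BilevelProgram.isBiLocalSolution_of_branch hρ hPhi (hy.differentiableAt (by simp)) hlt
      (hgrowth.mono fun x hx hxPhi => ?_)
    have := hx hxPhi
    nlinarith [mul_nonneg hγ.le (sq_nonneg ‖x - xs‖)]
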